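/- Let $\underline{C}$ be a (locally small) triangulated category that has all small coproducts. For a class $\mathcal{Q}$ of objects of $\underline C$, write $\mathcal{Q}^\perp=\{N : \underline{C}(M,N)=0 \text{ for all } M\in \mathcal{Q}\}$, and let $[\mathcal{Q}]^{cl}$ be the smallest class of objects that contains $\mathcal{Q}$ and is closed under small coproducts and under extensions (if $A\to B\to D\to A[1]$ is distinguished and $A,D$ are in the class, then so is $B$). Let $P$ be an object of $\underline{C}$ such that $\underline C$ is compactly generated by $P$ (that is, $P$ is compact and $[\{P[i] : i\in\mathbb{Z}\}]^{cl}$ is the class of all objects of $\underline{C}$) and $P$ is connective, i.e. $\underline{C}(P,P[i])=0$ for all $i>0$. Let $R=\mathrm{End}(P)^{op}$, let $R\text{-Mod}$ be the category of left $R$-modules, and let $\mathrm{Proj}\,R\text{-Mod}$ be its full subcategory of projective modules. A weight structure $w$ on $\underline{C}$ is a pair of classes $\underline{C}_{w\le 0},\underline{C}_{w\ge 0}$ closed under direct summands such that $\underline{C}_{w\le 0}\subset \underline{C}_{w\le 0}[1]$, $\underline{C}_{w\ge 0}[1]\subset \underline{C}_{w\ge 0}$, there are no non-zero morphisms from $\underline{C}_{w\le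 0}$ to $\underline{C}_{w\ge 0}[1]$, and each object $M$ lies in a distinguished triangle $L\to M\to N\to L[1]$ with $L\in \underline{C}_{w\le 0}$, $N\in \underline{C}_{w\ge 0}[1]$. Its heart $\underline{Hw}$ is the full subcategory on $\underline{C}_{w=0}=\underline{C}_{w\le 0}\cap\underline{C}_{w\ge 0}$. It is smashing if $\underline{C}_{w\ge 0}$ is closed under small coproducts. For $t$-structures the homological convention is used: $\underline{C}_{t\ge 0}[1]\subset\underline{C}_{t\ge 0}$, there are no non-zero morphisms from $\underline{C}_{t\ge 0}[1]$ to $\underline{C}_{t\le 0}$, and the heart $\underline{Ht}$ is the full subcategory on $\underline{C}_{t\ge 0}\cap \underline{C}_{t\le 0}$. 1. Then $\underline{C}$ is well generated (that is, $\alpha$-well generated for some $\alpha$ that equals $\aleph_0$ or is an infinite successor cardinal: there is a set $\mathcal{P}$ of objects with $[\bigcup_{i\in\mathbb{Z}}\mathcal{P}[i]]^{cl}$ equal to the class of all objects such that $H=\coprod_{X\in\mathcal{P}}\underline{C}(X,-)$ satisfies, for all families, $\varinjlim_{J\subset I,\,|J|<\alpha}H(\coprod_{J}N_i)\cong H(\coprod_I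 N_i)$, and $H(\coprod f_i)$ is surjective whenever all the $H(f_i)$ are). The object $P$ class-generates a smashing weight structure $w$ on $\underline{C}$, i.e. there is a smashing weight structure $w$ with $\underline{C}_{w\ge 0}=[\{P[i] : i\ge 0\}]^{cl}$ and $\underline{C}_{w\le 0}=[\{P[i] : i\le 0\}]^{cl}$. There is an equivalence of categories $\underline{Hw}\cong \mathrm{Proj}\,R\text{-Mod}$, and the elements of $\underline{C}_{w=0}$ are exactly the direct summands of the small coproduct powers $\coprod_I P$. 2. There is a $t$-structure $t$ on $\underline{C}$ that is adjacent to $w$, i.e. $\underline{C}_{t\ge 0}=\underline{C}_{w\ge 0}$, and $\underline{Ht}$ is equivalent to $R\text{-Mod}$. Moreover, $\underline{C}_{t\ge 0}=\underline{C}_{w\ge 0}=\{P[i] : i<0\}^\perp$ and $\underline{C}_{t\le 0}=\{P[i] : i>0\}^\perp$. -/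

import Mathlib

open CategoryTheory Limits Pretriangulated Triangulated Opposite
open scoped Cardinal

universe v u

noncomputable section

namespace WeightT

/-! Throughout, `C : Type u` is a category whose morphism sets lie in `Type v`, and "small" means
indexed by a type in `Type v`. -/

section Coproducts

variable {C : Type u} [Category.{v} C] [HasCoproducts.{v} C]

/-- The diagram of partial coproducts `J ↦ ∐_{i ∈ J} N i`, indexed by the poset of all subsets
`J ⊆ I` of cardinality `< α`. -/
def partialCoproducts (α : Cardinal.{v}) {I : Type v} (N : I → C) :
    {J : Set I // #J < α} ⥤ C where
  obj J := ∐ fun i : J.1 => N i.1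
  map {J J'} h := Sigma.desc fun i : J.1 =>
    Sigma.ι (fun i : J'.1 => N i.1) ⟨i.1, leOfHom h i.2⟩
  map_id J := by ext; simp
  map_comp f g := by ext; simp

/-- The canonical cocone with vertex `∐_{i ∈ I} N i` over the diagram of partial coproducts. -/
def partialCoproductsCocone (α : Cardinal.{v}) {I : Type v} (N : I → C) :
    Cocone (partialCoproducts α N) where
  pt := ∐ N
  ι :=
    { app := fun J => Sigma.desc fun i : J.1 => Sigma.ι N i.1
      naturality := by
        intro J J' h
        dsimp [partialCoproducts]
        ext
        simp }

variable [Preadditive C]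

/-- The functor `H^Q = ∐_{X ∈ Q} C(X, -)` with values in abelian groups, for a small set `Q` of
objects, given as the set of members of a family `p`. -/
def homFunctor {ι : Type v} (p : ι → C) : C ⥤ AddCommGrpCat.{v} :=
  ∐ fun i => preadditiveCoyoneda.obj (op (p i))

/-- The small set of objects `{p i}` is `α`-perfect, where `α` is either `ℵ₀` or an infinite
successor cardinal. -/
structure IsPerfect (α : Cardinal.{v}) {ι : Type v} (p : ι → C) : Prop where
  aleph0_le : ℵ₀ ≤ α
  aleph0_or_succ : α = ℵ₀ ∨ ∃ α' : Cardinal.{v}, α = Order.succ α'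
  /-- `H(∐_I N i)` is the colimit of `H(∐_J N i)`, for `J ⊆ I` of cardinality `< α`. -/
  isColimit {I : Type v} (N : I → C) :
    Nonempty (IsColimit ((homFunctor p).mapCocone (partialCoproductsCocone α N)))
  /-- `H(∐ f i)` is surjective if all the `H(f i)` are. -/
  surjective {I : Type v} {M N : I → C} (f : ∀ i, M i ⟶ N i)
    (hf : ∀ i, Function.Surjective ((homFunctor p).map (f i))) :
    Function.Surjective ((homFunctor p).map (Limits.Sigma.map f))

end Coproducts

variable {C : Type u} [Category.{v} C] [Preadditive C] [HasZeroObject C] [HasShift C ℤ]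
  [∀ n : ℤ, (shiftFunctor C n).Additive] [Pretriangulated C]

/-- `[Q]^cl`: the smallest class of objects that contains `Q`, is closed under small coproducts
and is closed under extensions. -/
inductive extCoprodClosure (Q : ObjectProperty C) : ObjectProperty C
  | of (X : C) (hX : Q X) : extCoprodClosure Q X
  | coproduct {I : Type v} (N : I → C) (c : Cofan N) (hc : IsColimit c)
      (hN : ∀ i, extCoprodClosure Q (N i)) : extCoprodClosure Q c.pt
  | extension (T : Triangle C) (hT : T ∈ distTriang C) (h₁ : extCoprodClosure Q T.obj₁)
      (h₃ : extCoprodClosure Q T.obj₃) : extCoprodClosure Q T.obj₂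

/-- `⋃_{i ∈ S} Q[i]`: the objects isomorphic to `X[i]` for some `X ∈ Q` and `i ∈ S`. -/
def shifts (Q : ObjectProperty C) (S : Set ℤ) : ObjectProperty C :=
  fun Y => ∃ i ∈ S, ∃ X : C, Q X ∧ Nonempty (Y ≅ X⟦i⟧)

/-- The objects of the localizing subcategory generated by `Q`. -/
def localizingClosure (Q : ObjectProperty C) : ObjectProperty C :=
  extCoprodClosure (shifts Q Set.univ)

/-- The class `Q` is connective: `Q ⊥ ⋃_{i > 0} Q[i]`. -/
def IsConnective (Q : ObjectProperty C) : Prop :=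
  ∀ ⦃X Y : C⦄, Q X → Q Y → ∀ i : ℤ, 0 < i → ∀ f : X ⟶ Y⟦i⟧, f = 0

section Generation

variable [HasCoproducts.{v} C]

/-- `C` is `α`-well generated by the set `{p i}`. -/
def IsWellGeneratedBy (α : Cardinal.{v}) {ι : Type v} (p : ι → C) : Prop :=
  IsPerfect α p ∧ localizingClosure (ObjectProperty.ofObj p) = ⊤

/-- `C` is compactly generated by the set `{p i}`. -/
def IsCompactlyGeneratedBy {ι : Type v} (p : ι → C) : Prop :=
  IsWellGeneratedBy ℵ₀ p

variable (C) in
/-- `C` is well generated. -/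
def IsWellGenerated : Prop :=
  ∃ (α : Cardinal.{v}) (ι : Type v) (p : ι → C), IsWellGeneratedBy α p

end Generation

variable (C) in
/-- A weight structure `w` on `C`; `le` is the class `C_{w ≤ 0}` and `ge` is the class
`C_{w ≥ 0}`. (In a triangulated category the direct summands of an object are its retracts.) -/
structure WeightStructure where
  le : ObjectProperty C
  ge : ObjectProperty C
  le_retract : le.IsStableUnderRetracts
  ge_retract : ge.IsStableUnderRetracts
  /-- `C_{w ≤ 0} ⊆ C_{w ≤ 0}[1]` -/
  le_shift (X : C) (hX : le X) : le (X⟦(-1 : ℤ)⟧)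
  /-- `C_{w ≥ 0}[1] ⊆ C_{w ≥ 0}` -/
  ge_shift (X : C) (hX : ge X) : ge (X⟦(1 : ℤ)⟧)
  /-- `C_{w ≤ 0} ⊥ C_{w ≥ 0}[1]` -/
  orthogonal ⦃X Y : C⦄ (hX : le X) (hY : ge Y) (f : X ⟶ Y⟦(1 : ℤ)⟧) : f = 0
  /-- Weight decompositions `L ⟶ M ⟶ R[1] ⟶ L[1]`, with `L ∈ C_{w ≤ 0}` and `R ∈ C_{w ≥ 0}`. -/
  exists_decomposition (M : C) : ∃ (L R : C) (_ : le L) (_ : ge R) (f : L ⟶ M)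
    (g : M ⟶ R⟦(1 : ℤ)⟧) (h : R⟦(1 : ℤ)⟧ ⟶ L⟦(1 : ℤ)⟧), Triangle.mk f g h ∈ distTriang C

namespace WeightStructure

variable (w : WeightStructure C)

/-- The class `C_{w = 0}` of objects of the heart `Hw`. -/
def heart : ObjectProperty C := w.ge ⊓ w.le

/-- `w` is smashing: `C` has small coproducts and `C_{w ≥ 0}` is closed under them. -/
def IsSmashing : Prop :=
  HasCoproducts.{v} C ∧ ∀ I : Type v, w.ge.IsClosedUnderColimitsOfShape (Discrete I)

/-- The class `Q` class-generates `w`. -/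
def IsClassGeneratedBy (Q : ObjectProperty C) : Prop :=
  HasCoproducts.{v} C ∧ w.ge = extCoprodClosure (shifts Q {i | 0 ≤ i}) ∧
    w.le = extCoprodClosure (shifts Q {i | i ≤ 0})

/-- `w` and the t-structure `t` are adjacent: `C_{w ≥ 0} = C_{t ≥ 0}`. Here `C_{t ≥ 0}` is written
in the homological convention; in the cohomological convention of `TStructure` it is the class
`t.le 0` (and the homological `C_{t ≤ 0}` is `t.ge 0`). -/
def IsAdjacent (t : TStructure C) : Prop := w.ge = t.le 0

end WeightStructure

/-- The category of projective left `R`-modules. -/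
abbrev ProjMod (R : Type v) [Ring R] :=
  ObjectProperty.FullSubcategory (fun M : ModuleCat.{v} R => Module.Projective R M)

end WeightT

end

/-! Well-generation is the hypothesis itself, with `α = ℵ₀`. Beyond that, compactness enters in one
form: a map from `P` to a coproduct is a finite sum of maps to summands (`IsFinitary`). With
connectivity, induction over the closure shows that objects built from `P⟦i⟧`, `i ≤ n`, have no
non-zero maps to objects built from `P⟦j⟧`, `j > n`.

Weight structure: the objects admitting a decomposition at level `n` include every `P⟦i⟧` and are
closed under coproducts and, by octahedra and orthogonality (`exists_decomposition_of_extension`),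
under extensions; so they are all objects. Retracts stay in the classes by a swindle on countable
coproducts (`exists_splitting_of_idempotent`). If `X` receives no maps from `P⟦i⟧`, `i < n`, its
decomposition splits, which gives `genBy_ge_eq_perpBy`.

t-structure: truncations are homotopy colimits of cell attachments (`exists_truncation_triangle`).

Hearts: both are compared with modules through `Hom(P, -)`, which sends `∐_I P` to a free module.
The main tool is `exists_cover`: an object of non-negative weight is covered by copies of `P`, with
cone of weight at least `1`. The cover splits on the heart of `w`, and acts as the start of a free
presentation on the heart of `t`. -/

noncomputable section

namespace WeightT

set_option linter.unusedSectionVars false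

/-! ### Finitary objects -/

section Finitary

variable {C : Type u} [Category.{v} C] [Preadditive C]

/-- The projection from a coproduct onto one of its summands. -/
def cofanProj {I : Type*} {N : I → C} {c : Cofan N} (hc : IsColimit c) (i : I) : c.pt ⟶ N i :=
  open Classical in
  Cofan.IsColimit.desc hc fun j => if h : j = i then eqToHom (by rw [h]) else 0

lemma inj_cofanProj_self {I : Type*} {N : I → C} {c : Cofan N} (hc : IsColimit c) (i : I) :
    c.inj i ≫ cofanProj hc i = 𝟙 _ := by
  simp [cofanProj, Cofan.IsColimit.fac]

lemma inj_cofanProj_of_ne {I : Type*} {N : I → C} {c : Cofan N} (hc : IsColimit c) {i j : I}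
    (h : j ≠ i) : c.inj j ≫ cofanProj hc i = 0 := by
  simp [cofanProj, Cofan.IsColimit.fac, h]

lemma inj_cofanProj_self_assoc {I : Type*} {N : I → C} {c : Cofan N} (hc : IsColimit c) (i : I)
    {W : C} (f : N i ⟶ W) : c.inj i ≫ cofanProj hc i ≫ f = f := by
  rw [← Category.assoc, inj_cofanProj_self, Category.id_comp]

lemma inj_cofanProj_of_ne_assoc {I : Type*} {N : I → C} {c : Cofan N} (hc : IsColimit c) {i j : I}
    (h : j ≠ i) {W : C} (f : N i ⟶ W) : c.inj j ≫ cofanProj hc i ≫ f = 0 := by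
  rw [← Category.assoc, inj_cofanProj_of_ne hc h, zero_comp]

/-- `K` is finitary if every morphism from `K` to a small coproduct is a finite sum of morphisms
that factor through the inclusions of the summands. -/
def IsFinitary (K : C) : Prop :=
  ∀ {I : Type v} (N : I → C) (c : Cofan N), IsColimit c → ∀ x : K ⟶ c.pt,
    ∃ (s : Finset I) (y : ∀ i, K ⟶ N i), x = ∑ i ∈ s, y i ≫ c.inj i

lemma sum_comp_cofanProj {I : Type*} {N : I → C} {c : Cofan N} (hc : IsColimit c) {K : C}
    [DecidableEq I] (s : Finset I) (y : ∀ i, K ⟶ N i) (j : I) :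
    (∑ i ∈ s, y i ≫ c.inj i) ≫ cofanProj hc j = if j ∈ s then y j else 0 := by
  rw [Preadditive.sum_comp]
  split_ifs with hj
  · rw [Finset.sum_eq_single_of_mem j hj, Category.assoc, inj_cofanProj_self, Category.comp_id]
    intro b _ hb
    rw [Category.assoc, inj_cofanProj_of_ne hc hb, comp_zero]
  · refine Finset.sum_eq_zero fun b hb => ?_
    rw [Category.assoc, inj_cofanProj_of_ne hc (by rintro rfl; exact hj hb), comp_zero]

lemma IsFinitary.exists_finset {K : C} (hK : IsFinitary K) {I : Type v} {N : I → C} {c : Cofan N}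
    (hc : IsColimit c) (x : K ⟶ c.pt) :
    ∃ s : Finset I, (∀ i ∉ s, x ≫ cofanProj hc i = 0) ∧
      x = ∑ i ∈ s, (x ≫ cofanProj hc i) ≫ c.inj i := by
  classical
  obtain ⟨s, y, rfl⟩ := hK N c hc x
  refine ⟨s, fun i hi => by rw [sum_comp_cofanProj, if_neg hi], ?_⟩
  refine Finset.sum_congr rfl fun i hi => ?_
  rw [sum_comp_cofanProj, if_pos hi]

lemma IsFinitary.eq_zero_of_proj {K : C} (hK : IsFinitary K) {I : Type v} {N : I → C}
    {c : Cofan N} (hc : IsColimit c) (x : K ⟶ c.pt) (hx : ∀ i, x ≫ cofanProj hc i = 0) :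
    x = 0 := by
  obtain ⟨s, -, hs⟩ := hK.exists_finset hc x
  rw [hs]
  exact Finset.sum_eq_zero fun i _ => by rw [hx, zero_comp]

lemma IsFinitary.eq_zero_of_coproduct {K : C} (hK : IsFinitary K) {I : Type v} {N : I → C}
    {c : Cofan N} (hc : IsColimit c) (hN : ∀ i, ∀ f : K ⟶ N i, f = 0) (x : K ⟶ c.pt) :
    x = 0 :=
  hK.eq_zero_of_proj hc x fun i => hN i _

/-- A map out of `F.obj K` is transposed, decomposed in the coproduct preserved by `G`, and
transposed back. -/
lemma IsFinitary.of_adjunction {F G : C ⥤ C} (adj : F ⊣ G) [F.Additive] [G.Additive]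
    [∀ I : Type v, PreservesColimitsOfShape (Discrete I) G] {K : C} (hK : IsFinitary K) :
    IsFinitary (F.obj K) := by
  intro I N c hc x
  obtain ⟨s, y, hy⟩ := hK _ _ (Cofan.isColimitMapCoconeEquiv G N c (isColimitOfPreserves G hc))
    (adj.homEquiv _ _ x)
  refine ⟨s, fun i => (adj.homEquiv _ _).symm (y i), ?_⟩
  apply (adj.homEquiv _ _).injective
  rw [hy, ← Adjunction.homAddEquiv_apply, map_sum]
  refine Finset.sum_congr rfl fun i _ => ?_
  rw [Adjunction.homAddEquiv_apply, adj.homEquiv_naturality_right]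
  simp

lemma IsFinitary.shift [HasShift C ℤ] [∀ n : ℤ, (shiftFunctor C n).Additive] {K : C}
    (hK : IsFinitary K) (n : ℤ) : IsFinitary (K⟦n⟧) :=
  hK.of_adjunction (F := shiftFunctor C n) (G := shiftFunctor C (-n))
    (shiftEquiv' C n (-n) (by simp)).toAdjunction

end Finitary

/-! ### Compact objects are finitary -/

section Perfect

variable {C : Type u} [Category.{v} C] [HasCoproducts.{v} C] [Preadditive C]

/-- Filteredness lets the colimit of abelian groups be computed on underlying sets, so each element
is represented at a finite stage. -/
instance (I : Type v) : IsFiltered {J : Set I // #J < ℵ₀} :=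
  haveI : Nonempty {J : Set I // #J < ℵ₀} := ⟨⟨∅, by simp [Cardinal.aleph0_pos]⟩⟩
  haveI : IsDirectedOrder {J : Set I // #J < ℵ₀} := ⟨fun J J' => by
    refine ⟨⟨J.1 ∪ J'.1, ?_⟩, Set.subset_union_left, Set.subset_union_right⟩
    exact (Cardinal.mk_union_le _ _).trans_lt (Cardinal.add_lt_aleph0 J.2 J'.2)⟩
  isFiltered_of_directed_le_nonempty _

lemma IsPerfect.isFinitary {P : C} (hP : IsPerfect ℵ₀ (fun _ : PUnit.{v + 1} => P)) :
    IsFinitary P := by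
  classical
  suffices h : ∀ {I : Type v} (N : I → C) (x : P ⟶ ∐ N),
      ∃ (s : Finset I) (y : ∀ i, P ⟶ N i), x = ∑ i ∈ s, y i ≫ Sigma.ι N i by
    intro I N c hc x
    let e := hc.coconePointUniqueUpToIso (coproductIsCoproduct N)
    obtain ⟨s, y, hy⟩ := h N (x ≫ e.hom)
    refine ⟨s, y, ?_⟩
    rw [← cancel_mono e.hom, hy, Preadditive.sum_comp]
    refine Finset.sum_congr rfl fun i _ => ?_
    rw [Category.assoc]
    congr 1
    exact (hc.comp_coconePointUniqueUpToIso_hom (coproductIsCoproduct N) ⟨i⟩).symm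
  intro I N x
  obtain ⟨hc⟩ := hP.isColimit N
  let e : homFunctor (fun _ : PUnit.{v + 1} => P) ≅ preadditiveCoyoneda.obj (op P) :=
    coproductUniqueIso _
  have hc' := (IsColimit.mapCoconeEquiv e) hc
  obtain ⟨J, y, hy⟩ := Concrete.isColimit_exists_rep _ hc' x
  change P ⟶ ∐ fun i : J.1 => N i.1 at y
  change y ≫ Sigma.desc (fun i : J.1 => Sigma.ι N i.1) = x at hy
  have hJ : Finite J.1 := Cardinal.lt_aleph0_iff_finite.1 J.2
  cases nonempty_fintype J.1
  -- A finite coproduct is a biproduct.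
  have hid : 𝟙 (∐ fun i : J.1 => N i.1) =
      ∑ j : J.1, cofanProj (coproductIsCoproduct fun i : J.1 => N i.1) j ≫
        Sigma.ι (fun i : J.1 => N i.1) j := by
    refine Sigma.hom_ext _ _ fun j => ?_
    rw [Preadditive.comp_sum, Finset.sum_eq_single j, Category.comp_id]
    · exact (inj_cofanProj_self_assoc (coproductIsCoproduct fun i : J.1 => N i.1) j
        _).symm
    · intro k _ hk
      exact (inj_cofanProj_of_ne_assoc (coproductIsCoproduct fun i : J.1 => N i.1) hk.symm _)
    · simp
  refine ⟨Finset.univ.map (Function.Embedding.subtype (· ∈ J.1)), fun i => if h : i ∈ J.1 then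
    y ≫ cofanProj (coproductIsCoproduct fun i : J.1 => N i.1) ⟨i, h⟩ else 0, ?_⟩
  rw [← hy, ← Category.id_comp (Sigma.desc _), hid, Preadditive.sum_comp, Preadditive.comp_sum,
    Finset.sum_map]
  refine Finset.sum_congr rfl fun j _ => ?_
  simp

end Perfect

/-! ### Shifts of coproducts -/

section Shift

variable {C : Type u} [Category.{v} C] [HasShift C ℤ]

/-- The shift of a coproduct is a coproduct. -/
def isColimitShiftCofan {I : Type*} {N : I → C} {c : Cofan N} (hc : IsColimit c) (n : ℤ) :
    IsColimit (Cofan.mk (c.pt⟦n⟧) fun i => (c.inj i)⟦n⟧' : Cofan fun i => (N i)⟦n⟧) :=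
  Cofan.isColimitMapCoconeEquiv (shiftFunctor C n) N c (isColimitOfPreserves _ hc)

lemma exists_shift_desc {I : Type*} {N : I → C} {c : Cofan N} (hc : IsColimit c) (n : ℤ) {W : C}
    (y : ∀ i, (N i)⟦n⟧ ⟶ W) : ∃ z : c.pt⟦n⟧ ⟶ W, ∀ i, (c.inj i)⟦n⟧' ≫ z = y i :=
  ⟨Cofan.IsColimit.desc (isColimitShiftCofan hc n) y,
    fun i => Cofan.IsColimit.fac (isColimitShiftCofan hc n) y i⟩

lemma shift_hom_ext {I : Type*} {N : I → C} {c : Cofan N} (hc : IsColimit c) (n : ℤ) {W : C}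
    {y z : c.pt⟦n⟧ ⟶ W} (h : ∀ i, (c.inj i)⟦n⟧' ≫ y = (c.inj i)⟦n⟧' ≫ z) : y = z :=
  Cofan.IsColimit.hom_ext (isColimitShiftCofan hc n) _ _ h

end Shift

/-! ### Coproducts of triangles, idempotents, homotopy colimits -/

section Triangles

variable {C : Type u} [Category.{v} C] [Preadditive C] [HasZeroObject C] [HasShift C ℤ]
  [∀ n : ℤ, (shiftFunctor C n).Additive] [Pretriangulated C]

section Exactness

variable {X Y Z W : C} {f : X ⟶ Y} {g : Y ⟶ Z} {h : Z ⟶ X⟦(1 : ℤ)⟧}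

lemma distTriang_comp₁₂ (hT : Triangle.mk f g h ∈ distTriang C) : f ≫ g = 0 :=
  comp_distTriang_mor_zero₁₂ _ hT

lemma distTriang_comp₃₁ (hT : Triangle.mk f g h ∈ distTriang C) : h ≫ f⟦(1 : ℤ)⟧' = 0 :=
  comp_distTriang_mor_zero₃₁ _ hT

lemma distTriang_desc₂ (hT : Triangle.mk f g h ∈ distTriang C) (x : Y ⟶ W) (hx : f ≫ x = 0) :
    ∃ y : Z ⟶ W, x = g ≫ y :=
  Triangle.yoneda_exact₂ _ hT x hx

lemma distTriang_desc₃ (hT : Triangle.mk f g h ∈ distTriang C) (x : Z ⟶ W) (hx : g ≫ x = 0) :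
    ∃ y : X⟦(1 : ℤ)⟧ ⟶ W, x = h ≫ y :=
  Triangle.yoneda_exact₃ _ hT x hx

lemma distTriang_lift₂ (hT : Triangle.mk f g h ∈ distTriang C) (x : W ⟶ Y) (hx : x ≫ g = 0) :
    ∃ y : W ⟶ X, x = y ≫ f :=
  Triangle.coyoneda_exact₂ _ hT x hx

lemma distTriang_lift₃ (hT : Triangle.mk f g h ∈ distTriang C) (x : W ⟶ Z) (hx : x ≫ h = 0) :
    ∃ y : W ⟶ Y, x = y ≫ g :=
  Triangle.coyoneda_exact₃ _ hT x hx

lemma distTriang_rotate (hT : Triangle.mk f g h ∈ distTriang C) :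
    Triangle.mk g h (-f⟦(1 : ℤ)⟧') ∈ distTriang C :=
  rot_of_distTriang _ hT

lemma distTriang_invRotate (hT : Triangle.mk f g h ∈ distTriang C) :
    ∃ (u : Z⟦(-1 : ℤ)⟧ ⟶ X) (w : Y ⟶ (Z⟦(-1 : ℤ)⟧)⟦(1 : ℤ)⟧),
      Triangle.mk u f w ∈ distTriang C :=
  ⟨_, _, inv_rot_of_distTriang _ hT⟩

lemma distTriang_of_iso₃ {Z' : C} (hT : Triangle.mk f g h ∈ distTriang C) (e : Z ≅ Z') :
    Triangle.mk f (g ≫ e.hom) (e.inv ≫ h) ∈ distTriang C :=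
  isomorphic_distinguished _ hT _ (Triangle.isoMk (Triangle.mk _ _ _) (Triangle.mk _ _ _)
    (Iso.refl X) (Iso.refl Y) e.symm ((Category.comp_id _).trans (Category.id_comp _).symm) (by
      change (g ≫ e.hom) ≫ e.inv = 𝟙 Y ≫ g
      simp) (by
      change (e.inv ≫ h) ≫ (𝟙 X)⟦(1 : ℤ)⟧' = e.inv ≫ h
      rw [CategoryTheory.Functor.map_id, Category.comp_id]))

end Exactness

/-- Coproducts of distinguished triangles are distinguished. -/
lemma exists_coproduct_triangle {I : Type*} (T : I → Triangle C) (hT : ∀ i, T i ∈ distTriang C)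
    {c₁ : Cofan fun i => (T i).obj₁} (hc₁ : IsColimit c₁)
    {c₂ : Cofan fun i => (T i).obj₂} (hc₂ : IsColimit c₂)
    {c₃ : Cofan fun i => (T i).obj₃} (hc₃ : IsColimit c₃) :
    ∃ (f : c₁.pt ⟶ c₂.pt) (g : c₂.pt ⟶ c₃.pt) (h : c₃.pt ⟶ c₁.pt⟦(1 : ℤ)⟧),
      Triangle.mk f g h ∈ distTriang C := by
  let f : c₁.pt ⟶ c₂.pt := Cofan.IsColimit.desc hc₁ fun i => (T i).mor₁ ≫ c₂.inj i
  have hf (i) : c₁.inj i ≫ f = (T i).mor₁ ≫ c₂.inj i := Cofan.IsColimit.fac hc₁ _ i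
  obtain ⟨Z, g, h, hZ⟩ := distinguished_cocone_triangle f
  have hk (i) : ∃ k : (T i).obj₃ ⟶ Z, (T i).mor₂ ≫ k = c₂.inj i ≫ g ∧
      (T i).mor₃ ≫ (c₁.inj i)⟦(1 : ℤ)⟧' = k ≫ h :=
    complete_distinguished_triangle_morphism (T i) _ (hT i) hZ (c₁.inj i) (c₂.inj i) (hf i).symm
  choose k hk₂ hk₃ using hk
  let φ : c₃.pt ⟶ Z := Cofan.IsColimit.desc hc₃ k
  have hφ (i) : c₃.inj i ≫ φ = k i := Cofan.IsColimit.fac hc₃ _ i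
  -- `φ` compares the coproduct of the third terms with the cone of `f`. It is epi by a chase in the
  -- sequences for `Hom(-, W)`; once it has a retraction `ψ`, it is an isomorphism.
  have hinj {W : C} (x : Z ⟶ W) (hx : φ ≫ x = 0) : x = 0 := by
    have hx' (i) : k i ≫ x = 0 := by rw [← hφ, Category.assoc, hx, comp_zero]
    obtain ⟨y, rfl⟩ := distTriang_desc₃ hZ x (by
      refine Cofan.IsColimit.hom_ext hc₂ _ _ fun i => ?_
      rw [← Category.assoc, ← hk₂, Category.assoc, hx', comp_zero, comp_zero])
    have hz (i) : ∃ z : (T i).obj₂⟦(1 : ℤ)⟧ ⟶ W,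
        (c₁.inj i)⟦(1 : ℤ)⟧' ≫ y = (T i).mor₁⟦(1 : ℤ)⟧' ≫ z := by
      obtain ⟨z, hz⟩ := distTriang_desc₃ (distTriang_rotate (hT i))
        ((c₁.inj i)⟦(1 : ℤ)⟧' ≫ y) (by
          rw [← Category.assoc, hk₃, Category.assoc, hx'])
      exact ⟨-z, by rw [hz]; simp⟩
    choose z hz using hz
    obtain ⟨w, hw⟩ := exists_shift_desc hc₂ 1 z
    have : y = f⟦(1 : ℤ)⟧' ≫ w := by
      refine shift_hom_ext hc₁ 1 fun i => ?_
      rw [hz, ← hw, ← Functor.map_comp_assoc, ← Functor.map_comp_assoc, hf]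
    rw [this, ← Category.assoc, distTriang_comp₃₁ hZ, zero_comp]
  obtain ⟨ψ, hψ⟩ : ∃ ψ : Z ⟶ c₃.pt, φ ≫ ψ = 𝟙 _ := by
    obtain ⟨x, hx⟩ := distTriang_desc₂ hZ
      (Cofan.IsColimit.desc hc₂ fun i => (T i).mor₂ ≫ c₃.inj i : c₂.pt ⟶ c₃.pt) (by
        refine Cofan.IsColimit.hom_ext hc₁ _ _ fun i => ?_
        rw [← Category.assoc, hf, Category.assoc, Cofan.IsColimit.fac, ← Category.assoc,
          comp_distTriang_mor_zero₁₂ _ (hT i), zero_comp, comp_zero])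
    -- The map `x` is right only up to a defect factoring through `(T i).mor₃`; adding `h ≫ w`
    -- corrects it.
    have hy (i) : ∃ y : (T i).obj₁⟦(1 : ℤ)⟧ ⟶ c₃.pt, c₃.inj i - k i ≫ x = (T i).mor₃ ≫ y :=
      Triangle.yoneda_exact₃ _ (hT i) _ (by
        rw [Preadditive.comp_sub, ← Category.assoc, hk₂, Category.assoc, ← hx,
          Cofan.IsColimit.fac, sub_self])
    choose y hy using hy
    obtain ⟨w, hw⟩ := exists_shift_desc hc₁ 1 y
    refine ⟨x + h ≫ w, Cofan.IsColimit.hom_ext hc₃ _ _ fun i => ?_⟩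
    rw [← Category.assoc, hφ, Preadditive.comp_add, ← Category.assoc (k i) h, ← hk₃,
      Category.assoc, hw, ← hy, Category.comp_id]
    abel
  have hψ' : ψ ≫ φ = 𝟙 _ := by
    rw [← sub_eq_zero]
    apply hinj
    rw [Preadditive.comp_sub, ← Category.assoc, hψ, Category.id_comp, Category.comp_id, sub_self]
  exact ⟨f, g ≫ ψ, φ ≫ h, distTriang_of_iso₃ hZ ⟨ψ, φ, hψ', hψ⟩⟩

variable [HasCoproducts.{v} C]

/-- Idempotents split: the object splitting `e : Y ⟶ Y` is the cone of an endomorphism of a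
countable coproduct of copies of `Y`. -/
lemma exists_splitting_of_idempotent {Y : C} (e : Y ⟶ Y) (he : e ≫ e = e) :
    ∃ (X : C) (f : (∐ fun _ : ULift.{v} ℕ => Y) ⟶ ∐ fun _ : ULift.{v} ℕ => Y)
      (g : (∐ fun _ : ULift.{v} ℕ => Y) ⟶ X) (i : X ⟶ Y) (p : Y ⟶ X),
      Triangle.mk f g 0 ∈ distTriang C ∧ i ≫ p = 𝟙 _ ∧ p ≫ i = e := by
  let S := ∐ fun _ : ULift.{v} ℕ => Y
  let ι (n : ℕ) : Y ⟶ S := Sigma.ι (fun _ : ULift.{v} ℕ => Y) ⟨n⟩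
  have ext' {W : C} {a b : S ⟶ W} (h : ∀ n, ι n ≫ a = ι n ≫ b) : a = b :=
    Sigma.hom_ext _ _ fun n => h n.down
  -- `u` is the identity on the `1 - e` part and the one-step shift on the `e` part. It is split
  -- mono with left inverse `r`, and its cokernel is the `e` part of the copy with index `0`,
  -- detected by `q`.
  let u : S ⟶ S := Sigma.desc fun n => (𝟙 _ - e) ≫ ι n.down + e ≫ ι (n.down + 1)
  have hu (n) : ι n ≫ u = (𝟙 _ - e) ≫ ι n + e ≫ ι (n + 1) := by simp [ι, u]
  let r : S ⟶ S := Sigma.desc fun n => (𝟙 _ - e) ≫ ι n.down +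
    (match n.down with | 0 => 0 | m + 1 => e ≫ ι m)
  have hr₀ : ι 0 ≫ r = (𝟙 _ - e) ≫ ι 0 := by simp [ι, r]
  have hr (n) : ι (n + 1) ≫ r = (𝟙 _ - e) ≫ ι (n + 1) + e ≫ ι n := by simp [ι, r]
  let q : S ⟶ Y := Sigma.desc fun n => match n.down with | 0 => e | _ + 1 => 0
  have hq₀ : ι 0 ≫ q = e := by simp [ι, q]
  have hq (n) : ι (n + 1) ≫ q = 0 := by simp [ι, q]
  have hee : e ≫ (𝟙 _ - e) = 0 := by simp [he]
  have hee' : (𝟙 _ - e) ≫ e = 0 := by simp [he]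
  have hee'' : (𝟙 _ - e) ≫ (𝟙 _ - e) = 𝟙 _ - e := by simp [he]
  have hur : u ≫ r = 𝟙 _ := ext' fun n => by
    rw [← Category.assoc, hu, Preadditive.add_comp, Category.assoc, Category.assoc, hr]
    cases n with
    | zero =>
      simp only [hr₀, Preadditive.comp_add, reassoc_of% hee, reassoc_of% hee'', reassoc_of% he]
      simp
    | succ n =>
      simp only [hr, Preadditive.comp_add, reassoc_of% hee, reassoc_of% hee', reassoc_of% hee'',
        reassoc_of% he]
      simp
  have hru : r ≫ u + q ≫ ι 0 = 𝟙 _ := ext' fun n => by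
    rw [Preadditive.comp_add, ← Category.assoc, ← Category.assoc]
    cases n with
    | zero =>
      rw [hr₀, hq₀, Category.assoc, hu]
      simp only [Preadditive.comp_add, reassoc_of% hee', reassoc_of% hee'']
      simp
    | succ n =>
      rw [hr, hq, Preadditive.add_comp, Category.assoc, Category.assoc, hu, hu]
      simp only [Preadditive.comp_add, reassoc_of% hee, reassoc_of% hee', reassoc_of% hee'',
        reassoc_of% he]
      simp
  have huq : u ≫ q = 0 := ext' fun n => by
    rw [← Category.assoc, hu, Preadditive.add_comp, Category.assoc, Category.assoc, hq]
    cases n with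
    | zero => simp [hq₀, he]
    | succ n => simp [hq]
  obtain ⟨X, g, h, hX⟩ := distinguished_cocone_triangle u
  have hu_mono : Mono u := mono_of_mono_fac hur
  have h0 : h = 0 := Triangle.mor₃_eq_zero_of_mono₁ _ hX hu_mono
  subst h0
  have hg_epi : Epi g := Triangle.epi₂ _ hX rfl
  have hug : u ≫ g = 0 := comp_distTriang_mor_zero₁₂ _ hX
  obtain ⟨i, hi⟩ := distTriang_desc₂ hX q huq
  refine ⟨X, u, g, i, ι 0 ≫ g, hX, ?_, ?_⟩
  · rw [← cancel_epi g, ← Category.assoc, ← hi, Category.comp_id]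
    have := hru =≫ g
    rw [Preadditive.add_comp, Category.assoc, hug, comp_zero, zero_add, Category.id_comp,
      Category.assoc] at this
    exact this
  · rw [Category.assoc, ← hi, hq₀]

lemma exists_triangle_of_retract {X Y : C} (h : Retract X Y) :
    ∃ (f : (∐ fun _ : ULift.{v} ℕ => Y) ⟶ ∐ fun _ : ULift.{v} ℕ => Y)
      (g : (∐ fun _ : ULift.{v} ℕ => Y) ⟶ X), Triangle.mk f g 0 ∈ distTriang C := by
  obtain ⟨X', f, g, i, p, hT, hip, hpi⟩ := exists_splitting_of_idempotent (h.r ≫ h.i) (by simp)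
  let e : X' ≅ X := ⟨i ≫ h.r, h.i ≫ p, by simp [← reassoc_of% hpi, hip], by
    rw [Category.assoc, reassoc_of% hpi]; simp⟩
  exact ⟨f, g ≫ e.hom, by simpa using distTriang_of_iso₃ hT e⟩

/-- Sequential homotopy colimits. -/
lemma exists_homotopy_colimit {A : ℕ → C} (t : ∀ n, A n ⟶ A (n + 1)) :
    ∃ (H : C) (f : (∐ fun n : ULift.{v} ℕ => A n.down) ⟶ ∐ fun n : ULift.{v} ℕ => A n.down)
      (g : (∐ fun n : ULift.{v} ℕ => A n.down) ⟶ H)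
      (h : H ⟶ (∐ fun n : ULift.{v} ℕ => A n.down)⟦(1 : ℤ)⟧) (a : ∀ n, A n ⟶ H),
      Triangle.mk f g h ∈ distTriang C ∧ (∀ n, t n ≫ a (n + 1) = a n) ∧
      (∀ {M : C} (b : ∀ n, A n ⟶ M), (∀ n, t n ≫ b (n + 1) = b n) →
        ∃ k : H ⟶ M, ∀ n, a n ≫ k = b n) ∧
      (∀ {K : C}, IsFinitary K → ∀ x : K ⟶ H, ∃ (n : ℕ) (y : K ⟶ A n), x = y ≫ a n) := by
  let N : ULift.{v} ℕ → C := fun n => A n.down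
  let ι (n : ℕ) : A n ⟶ ∐ N := Sigma.ι N ⟨n⟩
  have ext' {W : C} {a b : ∐ N ⟶ W} (h : ∀ n, ι n ≫ a = ι n ≫ b) : a = b :=
    Sigma.hom_ext _ _ fun n => h n.down
  -- The telescope map, identity minus shift.
  let f : ∐ N ⟶ ∐ N := Sigma.desc fun n => ι n.down - t n.down ≫ ι (n.down + 1)
  have hf (n) : ι n ≫ f = ι n - t n ≫ ι (n + 1) := by simp [ι, f]
  obtain ⟨H, g, h, hT⟩ := distinguished_cocone_triangle f
  have ha (n) : t n ≫ ι (n + 1) ≫ g = ι n ≫ g := by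
    have := ι n ≫= distTriang_comp₁₂ hT
    rw [← Category.assoc, hf, comp_zero, Preadditive.sub_comp, Category.assoc, sub_eq_zero] at this
    exact this.symm
  refine ⟨H, f, g, h, fun n => ι n ≫ g, hT, ha, fun b hb => ?_, fun hK x => ?_⟩
  · obtain ⟨k, hk⟩ := distTriang_desc₂ hT (Sigma.desc fun n => b n.down) (ext' fun n => by
      rw [← Category.assoc, hf, comp_zero, Preadditive.sub_comp, Category.assoc]
      simp [ι, hb])
    refine ⟨k, fun n => ?_⟩
    rw [Category.assoc, ← hk]
    simp [ι]
  · rename_i K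
    -- The components of `x ≫ h` satisfy a recursion expressing that `f⟦1⟧` kills it: the one at `0`
    -- vanishes, and each determines the next. A map from a finitary object with zero components is
    -- zero.
    have hh : x ≫ h = 0 := by
      let hc := isColimitShiftCofan (coproductIsCoproduct N) 1
      have hx : (x ≫ h) ≫ f⟦(1 : ℤ)⟧' = 0 := by
        rw [Category.assoc, distTriang_comp₃₁ hT, comp_zero]
      have hself (n) : (ι n)⟦(1 : ℤ)⟧' ≫ cofanProj hc ⟨n⟩ = 𝟙 _ := inj_cofanProj_self hc ⟨n⟩
      have hne {m n : ℕ} (hmn : m ≠ n) : (ι m)⟦(1 : ℤ)⟧' ≫ cofanProj hc ⟨n⟩ = 0 :=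
        inj_cofanProj_of_ne hc (by simpa using hmn)
      have hf₁ (n) : (ι n)⟦(1 : ℤ)⟧' ≫ f⟦(1 : ℤ)⟧' =
          (ι n)⟦(1 : ℤ)⟧' - (t n)⟦(1 : ℤ)⟧' ≫ (ι (n + 1))⟦(1 : ℤ)⟧' := by
        rw [← Functor.map_comp, hf, Functor.map_sub, Functor.map_comp]
      have hext {W : C} {a b : (∐ N)⟦(1 : ℤ)⟧ ⟶ W}
          (h : ∀ n, (ι n)⟦(1 : ℤ)⟧' ≫ a = (ι n)⟦(1 : ℤ)⟧' ≫ b) : a = b :=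
        shift_hom_ext (coproductIsCoproduct N) 1 fun n => h n.down
      have hx₀ : f⟦(1 : ℤ)⟧' ≫ cofanProj hc ⟨0⟩ = cofanProj hc ⟨0⟩ := hext fun m => by
        rw [← Category.assoc, hf₁, Preadditive.sub_comp, Category.assoc, hne m.succ_ne_zero,
          comp_zero, sub_zero]
      have hx₁ (n) : f⟦(1 : ℤ)⟧' ≫ cofanProj hc ⟨n + 1⟩ = cofanProj hc ⟨n + 1⟩ -
          cofanProj hc ⟨n⟩ ≫ (t n)⟦(1 : ℤ)⟧' := hext fun m => by
        rw [← Category.assoc, hf₁, Preadditive.sub_comp, Category.assoc, Preadditive.comp_sub]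
        congr 1
        by_cases hmn : m = n
        · subst hmn
          rw [hself, reassoc_of% (hself m), Category.comp_id]
        · rw [hne (by simpa using hmn), ← Category.assoc, hne hmn, comp_zero, zero_comp]
      have hp (n) : (x ≫ h) ≫ cofanProj hc ⟨n⟩ = 0 := by
        induction n with
        | zero => rw [← hx₀, ← Category.assoc, hx, zero_comp]
        | succ n ih =>
          have := hx =≫ cofanProj hc ⟨n + 1⟩
          rw [Category.assoc, hx₁, Preadditive.comp_sub, ← Category.assoc _ (cofanProj hc ⟨n⟩), ih,
            zero_comp, zero_comp, sub_zero] at this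
          exact this
      exact hK.eq_zero_of_proj hc (x ≫ h) fun n => hp n.down
    obtain ⟨y, rfl⟩ := distTriang_lift₃ hT x hh
    obtain ⟨s, z, rfl⟩ := hK N _ (coproductIsCoproduct N) y
    -- The finitely many summands are pushed to a common stage.
    have hstep {m n : ℕ} (hmn : m ≤ n) (w : K ⟶ A m) :
        ∃ w' : K ⟶ A n, w ≫ ι m ≫ g = w' ≫ ι n ≫ g := by
      induction n, hmn using Nat.le_induction with
      | base => exact ⟨w, rfl⟩
      | succ n _ ih =>
        obtain ⟨w', hw'⟩ := ih
        exact ⟨w' ≫ t n, by rw [hw', Category.assoc, ha]⟩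
    rw [Preadditive.sum_comp]
    clear hh
    induction s using Finset.cons_induction with
    | empty => exact ⟨0, 0, by simp⟩
    | cons j s hj ih =>
      obtain ⟨n, y, hy⟩ := ih
      obtain ⟨w₁, hw₁⟩ := hstep (le_max_left n j.down) y
      obtain ⟨w₂, hw₂⟩ := hstep (le_max_right n j.down) (z j)
      refine ⟨max n j.down, w₂ + w₁, ?_⟩
      rw [Finset.sum_cons, hy, hw₁, Preadditive.add_comp, ← hw₂, Category.assoc]
      rfl

end Triangles

/-! ### Generated classes and orthogonality -/

section Closure

variable {C : Type u} [Category.{v} C] [Preadditive C] [HasZeroObject C] [HasShift C ℤ]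
  [∀ n : ℤ, (shiftFunctor C n).Additive] [Pretriangulated C]

namespace extCoprodClosure

/-- An isomorphic object is the vertex of a coproduct with one summand. -/
lemma of_iso {Q : ObjectProperty C} {X Y : C} (e : X ≅ Y) (h : extCoprodClosure Q X) :
    extCoprodClosure Q Y :=
  coproduct (I := PUnit) (fun _ => X) (Cofan.mk Y fun _ => e.hom)
    (Cofan.isColimitMkOfUnique e _) fun _ => h

lemma extension_mk {Q : ObjectProperty C} {X Y Z : C} {f : X ⟶ Y} {g : Y ⟶ Z}
    {h : Z ⟶ X⟦(1 : ℤ)⟧} (hT : Triangle.mk f g h ∈ distTriang C) (hX : extCoprodClosure Q X)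
    (hZ : extCoprodClosure Q Z) : extCoprodClosure Q Y :=
  extension _ hT hX hZ

lemma of_isZero (Q : ObjectProperty C) {X : C} (hX : IsZero X) : extCoprodClosure Q X :=
  coproduct (I := PEmpty) PEmpty.elim (Cofan.mk X fun i => i.elim)
    (Cofan.IsColimit.mk _ (fun _ => hX.to_ _) (fun _ i => i.elim) fun _ _ _ => hX.eq_of_src _ _)
    fun i => i.elim

lemma mono {Q Q' : ObjectProperty C} (hQ : Q ≤ Q') {X : C} (h : extCoprodClosure Q X) :
    extCoprodClosure Q' X := by
  induction h with
  | of X hX => exact of X (hQ _ hX)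
  | coproduct N c hc _ ih => exact coproduct N c hc ih
  | extension T hT _ _ ih₁ ih₃ => exact extension T hT ih₁ ih₃

lemma shift {Q Q' : ObjectProperty C} {n : ℤ} (hQ : ∀ X, Q X → Q' (X⟦n⟧)) {X : C}
    (h : extCoprodClosure Q X) : extCoprodClosure Q' (X⟦n⟧) := by
  induction h with
  | of X hX => exact of _ (hQ _ hX)
  | coproduct N c hc _ ih => exact coproduct _ _ (isColimitShiftCofan hc n) ih
  | extension T hT _ _ ih₁ ih₃ =>
    exact extension ((Triangle.shiftFunctor C n).obj T) (Triangle.shift_distinguished T hT n)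
      ih₁ ih₃

lemma hom_eq_zero {Q : ObjectProperty C} {X Y : C} (h : extCoprodClosure Q X)
    (hQ : ∀ X, Q X → ∀ f : X ⟶ Y, f = 0) (f : X ⟶ Y) : f = 0 := by
  induction h with
  | of X hX => exact hQ X hX f
  | coproduct N c hc _ ih =>
    exact Cofan.IsColimit.hom_ext hc _ _ fun i => by rw [ih i (c.inj i ≫ f), comp_zero]
  | extension T hT _ _ ih₁ ih₃ =>
    obtain ⟨g, rfl⟩ := Triangle.yoneda_exact₂ T hT f (ih₁ _)
    rw [ih₃ g, comp_zero]

/-- Vanishing of maps into an object passes to coproducts only because `K` is finitary. -/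
lemma hom_eq_zero_of_isFinitary {K : C} (hK : IsFinitary K) {Q : ObjectProperty C} {X : C}
    (h : extCoprodClosure Q X) (hQ : ∀ X, Q X → ∀ f : K ⟶ X, f = 0) (f : K ⟶ X) : f = 0 := by
  induction h with
  | of X hX => exact hQ X hX f
  | coproduct N c hc _ ih => exact hK.eq_zero_of_coproduct hc ih f
  | extension T hT _ _ ih₁ ih₃ =>
    obtain ⟨g, rfl⟩ := Triangle.coyoneda_exact₂ T hT f (ih₃ _)
    rw [ih₁ g, zero_comp]

variable [HasCoproducts.{v} C]

lemma sigma {Q : ObjectProperty C} {I : Type v} {N : I → C} (h : ∀ i, extCoprodClosure Q (N i)) :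
    extCoprodClosure Q (∐ N) :=
  coproduct N _ (coproductIsCoproduct N) h

/-- With `S` the countable coproduct of copies of `Y`, the triangle `S ⟶ S ⟶ X`, rotated, makes `X`
an extension of `S⟦1⟧` by `S`. -/
lemma of_retract_of_shift {Q : ObjectProperty C}
    (hQ : ∀ X, extCoprodClosure Q X → extCoprodClosure Q (X⟦(1 : ℤ)⟧)) {X Y : C}
    (r : Retract X Y) (hY : extCoprodClosure Q Y) : extCoprodClosure Q X := by
  obtain ⟨f, g, hT⟩ := exists_triangle_of_retract r
  exact extension_mk (distTriang_rotate hT) (sigma fun _ => hY) (hQ _ (sigma fun _ => hY))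

/-- The triangle `S ⟶ S ⟶ X` splits, so `X ⊞ S ≅ S`; then `X` is an extension of `X ⊞ S` by `S⟦-1⟧`.
-/
lemma of_retract_of_shift_neg {Q : ObjectProperty C}
    (hQ : ∀ X, extCoprodClosure Q X → extCoprodClosure Q (X⟦(-1 : ℤ)⟧)) {X Y : C}
    (r : Retract X Y) (hY : extCoprodClosure Q Y) : extCoprodClosure Q X := by
  obtain ⟨f, g, hT⟩ := exists_triangle_of_retract r
  obtain ⟨e, -⟩ := exists_iso_binaryBiproduct_of_distTriang _ hT rfl
  have hS : extCoprodClosure Q (∐ fun _ : ULift.{v} ℕ => Y) := sigma fun _ => hY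
  exact extension _ (inv_rot_of_distTriang _ (binaryBiproductTriangle_distinguished X
    (∐ fun _ : ULift.{v} ℕ => Y))) (hQ _ hS) (of_iso (e ≪≫ biprod.braiding _ _) hS)

end extCoprodClosure

lemma shifts_singleton_shift {P : C} {S S' : Set ℤ} {n : ℤ} (h : ∀ i ∈ S, i + n ∈ S') (X : C)
    (hX : shifts (ObjectProperty.singleton P) S X) :
    shifts (ObjectProperty.singleton P) S' (X⟦n⟧) := by
  obtain ⟨i, hi, Y, hY, ⟨e⟩⟩ := hX
  exact ⟨i + n, h i hi, Y, hY, ⟨(shiftFunctor C n).mapIso e ≪≫ (shiftAdd Y i n).symm⟩⟩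

lemma shifts_singleton_mem (P : C) {S : Set ℤ} {i : ℤ} (hi : i ∈ S) :
    shifts (ObjectProperty.singleton P) S (P⟦i⟧) :=
  ⟨i, hi, P, by simp, ⟨Iso.refl _⟩⟩

lemma shifts_singleton_mono (P : C) {S S' : Set ℤ} (h : S ⊆ S') :
    shifts (ObjectProperty.singleton P) S ≤ shifts (ObjectProperty.singleton P) S' := by
  rintro X ⟨i, hi, Y, hY⟩
  exact ⟨i, h hi, Y, hY⟩

/-- The class generated by the objects `P⟦i⟧` for `i ∈ S` under small coproducts and extensions. -/
def genBy (P : C) (S : Set ℤ) : ObjectProperty C :=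
  extCoprodClosure (shifts (ObjectProperty.singleton P) S)

/-- The objects that receive only zero morphisms from `P⟦i⟧` for `i ∈ S`. -/
def perpBy (P : C) (S : Set ℤ) : ObjectProperty C :=
  (shifts (ObjectProperty.singleton P) S).rightOrthogonal

lemma perpBy_iff {P : C} {S : Set ℤ} {X : C} :
    perpBy P S X ↔ ∀ i ∈ S, ∀ f : P⟦i⟧ ⟶ X, f = 0 := by
  constructor
  · exact fun h i hi f => h f (shifts_singleton_mem P hi)
  · rintro h Y f ⟨i, hi, Z, hZ, ⟨e⟩⟩
    obtain rfl : P = Z := by simpa using hZ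
    rw [← cancel_epi e.inv, comp_zero]
    exact h i hi _

lemma genBy_mem (P : C) {S : Set ℤ} {i : ℤ} (hi : i ∈ S) : genBy P S (P⟦i⟧) :=
  .of _ (shifts_singleton_mem P hi)

lemma genBy_self (P : C) {S : Set ℤ} (h : 0 ∈ S) : genBy P S P :=
  (genBy_mem P h).of_iso ((shiftFunctorZero C ℤ).app P)

lemma genBy_mono {P : C} {S S' : Set ℤ} (h : S ⊆ S') {X : C} (hX : genBy P S X) : genBy P S' X :=
  hX.mono (shifts_singleton_mono P h)

lemma genBy_shift {P : C} {S S' : Set ℤ} {n : ℤ} (h : ∀ i ∈ S, i + n ∈ S') {X : C}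
    (hX : genBy P S X) : genBy P S' (X⟦n⟧) :=
  hX.shift (shifts_singleton_shift h)

lemma genBy_hom_eq_zero {P : C} {S : Set ℤ} {X Y : C} (hX : genBy P S X) (hY : perpBy P S Y)
    (f : X ⟶ Y) : f = 0 :=
  hX.hom_eq_zero (fun _ hZ g => hY g hZ) f

lemma perpBy_shift {P : C} {S S' : Set ℤ} {n : ℤ} (h : ∀ i ∈ S', i - n ∈ S) {X : C}
    (hX : perpBy P S X) : perpBy P S' (X⟦n⟧) := by
  rw [perpBy_iff]
  intro i hi f
  let e : P⟦i⟧ ≅ (P⟦i - n⟧)⟦n⟧ := (shiftFunctorAdd' C (i - n) n i (by lia)).app P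
  obtain ⟨g, hg⟩ := (shiftFunctor C n).map_surjective (e.inv ≫ f)
  rw [← cancel_epi e.inv, ← hg, perpBy_iff.1 hX _ (h i hi) g, Functor.map_zero, comp_zero]

lemma hom_shift_eq_zero_of_lt {P : C} (hconn : IsConnective (ObjectProperty.singleton P)) {i j : ℤ}
    (hij : i < j) (f : P⟦i⟧ ⟶ P⟦j⟧) : f = 0 := by
  let e : P⟦j⟧ ≅ (P⟦j - i⟧)⟦i⟧ := (shiftFunctorAdd' C (j - i) i j (by lia)).app P
  obtain ⟨g, hg⟩ := (shiftFunctor C i).map_surjective (f ≫ e.hom)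
  rw [← cancel_mono e.hom, ← hg, hconn (by simp) (by simp) (j - i) (by lia) g, Functor.map_zero,
    zero_comp]

/-- The class generated by `P⟦j⟧`, `j > n`, is right orthogonal to `P⟦i⟧`, `i ≤ n`. -/
lemma genBy_le_perpBy {P : C} (hP : IsFinitary P)
    (hconn : IsConnective (ObjectProperty.singleton P)) {S S' : Set ℤ}
    (h : ∀ i ∈ S', ∀ j ∈ S, i < j) {X : C} (hX : genBy P S X) : perpBy P S' X := by
  rw [perpBy_iff]
  intro i hi
  refine hX.hom_eq_zero_of_isFinitary (hP.shift i) ?_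
  rintro Y ⟨j, hj, Z, hZ, ⟨e⟩⟩ f
  obtain rfl : P = Z := by simpa using hZ
  rw [← cancel_mono e.hom, zero_comp]
  exact hom_shift_eq_zero_of_lt hconn (h i hi j hj) _

end Closure

/-! ### The weight structure -/

section Weight

variable {C : Type u} [Category.{v} C] [Preadditive C] [HasZeroObject C] [HasShift C ℤ]
  [∀ n : ℤ, (shiftFunctor C n).Additive] [Pretriangulated C] [IsTriangulated C]

lemma exists_octahedron_triangle {X Y Z A B D : C} {f : X ⟶ Y} {g : Y ⟶ Z} {f₁ : Y ⟶ A}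
    {f₂ : A ⟶ X⟦(1 : ℤ)⟧} (hf : Triangle.mk f f₁ f₂ ∈ distTriang C) {g₁ : Z ⟶ B}
    {g₂ : B ⟶ Y⟦(1 : ℤ)⟧} (hg : Triangle.mk g g₁ g₂ ∈ distTriang C) {k₁ : Z ⟶ D}
    {k₂ : D ⟶ X⟦(1 : ℤ)⟧} (hk : Triangle.mk (f ≫ g) k₁ k₂ ∈ distTriang C) :
    ∃ (a : A ⟶ D) (b : D ⟶ B) (c : B ⟶ A⟦(1 : ℤ)⟧), Triangle.mk a b c ∈ distTriang C :=
  let o := Triangulated.someOctahedron rfl hf hg hk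
  ⟨_, _, _, o.mem⟩

lemma exists_octahedron_triangle_fibre {X Y Z A B D : C} {f : X ⟶ Y} {g : Y ⟶ Z} {f₁ : A ⟶ X}
    {f₂ : Y ⟶ A⟦(1 : ℤ)⟧} (hf : Triangle.mk f₁ f f₂ ∈ distTriang C) {g₁ : B ⟶ Y}
    {g₂ : Z ⟶ B⟦(1 : ℤ)⟧} (hg : Triangle.mk g₁ g g₂ ∈ distTriang C) {k₁ : D ⟶ X}
    {k₂ : Z ⟶ D⟦(1 : ℤ)⟧} (hk : Triangle.mk k₁ (f ≫ g) k₂ ∈ distTriang C) :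
    ∃ (a : A ⟶ D) (b : D ⟶ B) (c : B ⟶ A⟦(1 : ℤ)⟧), Triangle.mk a b c ∈ distTriang C :=
  let o := Triangulated.someOctahedron' rfl hf hg hk
  ⟨_, _, _, o.mem⟩

/-- If the outer terms of a triangle decompose with pieces in `Q` and `Q'`, where
`Q ⊥ Q'⟦1⟧`, then so does the middle term. -/
lemma exists_decomposition_of_extension {Q Q' : ObjectProperty C} {M₁ M₂ M₃ L₁ N₁ L₃ N₃ : C}
    {u : M₁ ⟶ M₂} {v : M₂ ⟶ M₃} {w : M₃ ⟶ M₁⟦(1 : ℤ)⟧} (hM : Triangle.mk u v w ∈ distTriang C)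
    {f₁ : L₁ ⟶ M₁} {g₁ : M₁ ⟶ N₁} {h₁ : N₁ ⟶ L₁⟦(1 : ℤ)⟧}
    (hT₁ : Triangle.mk f₁ g₁ h₁ ∈ distTriang C)
    {f₃ : L₃ ⟶ M₃} {g₃ : M₃ ⟶ N₃} {h₃ : N₃ ⟶ L₃⟦(1 : ℤ)⟧}
    (hT₃ : Triangle.mk f₃ g₃ h₃ ∈ distTriang C)
    (hzero : ∀ f : L₃ ⟶ N₁⟦(1 : ℤ)⟧, f = 0)
    (hL₁ : extCoprodClosure Q L₁) (hL₃ : extCoprodClosure Q L₃)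
    (hN₁ : extCoprodClosure Q' N₁) (hN₃ : extCoprodClosure Q' N₃) :
    ∃ (L N : C) (f : L ⟶ M₂) (g : M₂ ⟶ N) (h : N ⟶ L⟦(1 : ℤ)⟧),
      extCoprodClosure Q L ∧ extCoprodClosure Q' N ∧ Triangle.mk f g h ∈ distTriang C := by
  -- `D` is an extension of `M₃` by `N₁`. The obstruction to lifting `f₃` to `D` lies in `Hom(L₃,
  -- N₁⟦1⟧) = 0`.
  obtain ⟨D, k, l, hD⟩ := distinguished_cocone_triangle (f₁ ≫ u)
  obtain ⟨a, b, c, habc⟩ := exists_octahedron_triangle hT₁ hM hD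
  obtain ⟨m, hm⟩ := distTriang_lift₃ habc f₃ (hzero _)
  subst hm
  -- The cone `N` of the lift is an extension of `N₃` by `N₁`, and the fibre `L` of `M₂ ⟶ D ⟶ N` is
  -- an extension of `L₃` by `L₁`.
  obtain ⟨N, p, q, hN⟩ := distinguished_cocone_triangle m
  obtain ⟨a', b', c', habc'⟩ := exists_octahedron_triangle hN (distTriang_rotate habc) hT₃
  obtain ⟨L, r, s, hL⟩ := distinguished_cocone_triangle₁ (k ≫ p)
  obtain ⟨a₂, b₂, c₂, h₂⟩ := exists_octahedron_triangle_fibre hD hN hL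
  refine ⟨L, N, r, k ≫ p, s, .extension_mk h₂ hL₁ hL₃, ?_, hL⟩
  exact .extension _ (inv_rot_of_distTriang _ habc')
    (hN₁.of_iso ((shiftEquiv C (1 : ℤ)).unitIso.app N₁)) hN₃

variable [HasCoproducts.{v} C]

-- Induction over the closure: a shift of `P` lies on one side of `n`, and decompositions pass to
-- coproducts and extensions.
open ZeroObject in
lemma exists_weight_decomposition {P : C} (hP : IsFinitary P)
    (hconn : IsConnective (ObjectProperty.singleton P)) (n : ℤ) {M : C}
    (hM : genBy P Set.univ M) :
    ∃ (L N : C) (f : L ⟶ M) (g : M ⟶ N) (h : N ⟶ L⟦(1 : ℤ)⟧),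
      genBy P {i | i ≤ n} L ∧ genBy P {i | n < i} N ∧ Triangle.mk f g h ∈ distTriang C := by
  induction hM with
  | of X hX =>
    obtain ⟨i, -, Y, hY, ⟨e⟩⟩ := hX
    obtain rfl : P = Y := by simpa using hY
    rcases le_or_gt i n with hi | hi
    · exact ⟨X, 0, 𝟙 X, 0, 0, (genBy_mem P (S := {i | i ≤ n}) hi).of_iso e.symm,
        .of_isZero _ (isZero_zero C), contractible_distinguished X⟩
    · exact ⟨0, X, 0, 𝟙 X, 0, .of_isZero _ (isZero_zero C),
        (genBy_mem P (S := {i | n < i}) hi).of_iso e.symm, contractible_distinguished₁ X⟩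
  | coproduct N c hc _ ih =>
    choose L R f g h hL hR hT using ih
    obtain ⟨f', g', h', hT'⟩ := exists_coproduct_triangle (fun i => Triangle.mk (f i) (g i) (h i))
      hT (coproductIsCoproduct L) hc (coproductIsCoproduct R)
    exact ⟨_, _, f', g', h', .sigma hL, .sigma hR, hT'⟩
  | extension T hT _ _ ih₁ ih₃ =>
    obtain ⟨L₁, N₁, f₁, g₁, h₁, hL₁, hN₁, hT₁⟩ := ih₁
    obtain ⟨L₃, N₃, f₃, g₃, h₃, hL₃, hN₃, hT₃⟩ := ih₃
    refine exists_decomposition_of_extension hT hT₁ hT₃ (fun f => ?_) hL₁ hL₃ hN₁ hN₃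
    have hN₁' : genBy P {i | n < i} (N₁⟦(1 : ℤ)⟧) :=
      genBy_shift (fun i (hi : n < i) => show n < i + 1 by lia) hN₁
    exact genBy_hom_eq_zero hL₃ (genBy_le_perpBy hP hconn
      (fun i (hi : i ≤ n) j (hj : n < j) => hi.trans_lt hj) hN₁') f

/-- If `X` is in the orthogonal, the map `L ⟶ X` of its decomposition at level `n - 1` vanishes, so
`X` is a retract of `N`. -/
lemma genBy_ge_eq_perpBy {P : C} (hP : IsFinitary P)
    (hconn : IsConnective (ObjectProperty.singleton P)) (hgen : genBy P Set.univ = ⊤) (n : ℤ) :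
    genBy P {i | n ≤ i} = perpBy P {i | i < n} := by
  apply le_antisymm
  · exact fun X hX => genBy_le_perpBy hP hconn
      (fun i (hi : i < n) j (hj : n ≤ j) => hi.trans_le hj) hX
  · intro X hX
    obtain ⟨L, N, f, g, h, hL, hN, hT⟩ := exists_weight_decomposition hP hconn (n - 1) (M := X)
      (by rw [hgen]; trivial)
    have hL' : genBy P {i | i < n} L := genBy_mono (fun i (hi : i ≤ n - 1) => by
      show i < n; lia) hL
    have hf : f = 0 := genBy_hom_eq_zero hL' hX f
    subst hf
    obtain ⟨r, hr⟩ := distTriang_desc₂ hT (𝟙 X) (by simp)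
    refine extCoprodClosure.of_retract_of_shift (fun Y hY => genBy_shift ?_ hY) ⟨g, r, hr.symm⟩
      (genBy_mono (fun i (hi : n - 1 < i) => by show n ≤ i; lia) hN)
    exact fun i (hi : n ≤ i) => show n ≤ i + 1 by lia

/-- The weight structure generated by a finitary connective generator. -/
def weightStructure {P : C} (hP : IsFinitary P)
    (hconn : IsConnective (ObjectProperty.singleton P)) (hgen : genBy P Set.univ = ⊤) :
    WeightStructure C where
  le := genBy P {i | i ≤ 0}
  ge := genBy P {i | 0 ≤ i}
  le_retract := ⟨fun r hY => extCoprodClosure.of_retract_of_shift_neg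
    (fun _ hX => genBy_shift (fun i (hi : i ≤ 0) => show i + -1 ≤ 0 by lia) hX) r hY⟩
  ge_retract := ⟨fun r hY => extCoprodClosure.of_retract_of_shift
    (fun _ hX => genBy_shift (fun i (hi : 0 ≤ i) => show 0 ≤ i + 1 by lia) hX) r hY⟩
  le_shift _ hX := genBy_shift (fun i (hi : i ≤ 0) => show i + -1 ≤ 0 by lia) hX
  ge_shift _ hX := genBy_shift (fun i (hi : 0 ≤ i) => show 0 ≤ i + 1 by lia) hX
  orthogonal X Y hX hY f := by
    have hY' : genBy P {i | 0 < i} (Y⟦(1 : ℤ)⟧) :=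
      genBy_shift (fun i (hi : 0 ≤ i) => show 0 < i + 1 by lia) hY
    exact genBy_hom_eq_zero hX (genBy_le_perpBy hP hconn
      (fun i (hi : i ≤ 0) j (hj : 0 < j) => hi.trans_lt hj) hY') f
  exists_decomposition M := by
    obtain ⟨L, N, f, g, h, hL, hN, hT⟩ := exists_weight_decomposition hP hconn 0 (M := M)
      (by rw [hgen]; trivial)
    exact ⟨L, N⟦(-1 : ℤ)⟧, hL, genBy_shift (fun i (hi : 0 < i) => show 0 ≤ i + -1 by lia) hN,
      f, _, _, distTriang_of_iso₃ hT ((shiftEquiv' C (-1 : ℤ) 1 (by simp)).unitIso.app N)⟩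

end Weight

/-! ### Truncation by attaching cells -/

section TruncationTriangle

variable {C : Type u} [Category.{v} C] [Preadditive C] [HasZeroObject C] [HasShift C ℤ]
  [∀ n : ℤ, (shiftFunctor C n).Additive] [Pretriangulated C] [HasCoproducts.{v} C]

lemma genBy_cone {P : C} {n : ℤ} {X Y Z : C} {f : X ⟶ Y} {g : Y ⟶ Z} {h : Z ⟶ X⟦(1 : ℤ)⟧}
    (hT : Triangle.mk f g h ∈ distTriang C) (hX : genBy P {i | n ≤ i} X)
    (hY : genBy P {i | n ≤ i} Y) : genBy P {i | n ≤ i} Z :=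
  .extension_mk (distTriang_rotate hT) hY
    (genBy_shift (fun i (hi : n ≤ i) => show n ≤ i + 1 by lia) hX)

/-- Attaching cells `P⟦i⟧`, `i ≥ n`, to `A` in order to kill the kernel of
`Hom(P⟦i⟧, A) ⟶ Hom(P⟦i⟧, M)`. -/
lemma exists_kill_kernel {P : C} {n : ℤ} {A M : C} (hA : genBy P {i | n ≤ i} A) (a : A ⟶ M) :
    ∃ (A' : C) (a' : A' ⟶ M) (t : A ⟶ A'), genBy P {i | n ≤ i} A' ∧ t ≫ a' = a ∧
      ∀ i, n ≤ i → ∀ z : P⟦i⟧ ⟶ A, z ≫ a = 0 → z ≫ t = 0 := by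
  let I := Σ i : {i : ℤ // n ≤ i}, {z : P⟦i.1⟧ ⟶ A // z ≫ a = 0}
  let N : I → C := fun j => P⟦j.1.1⟧
  let d : ∐ N ⟶ A := Sigma.desc fun j => j.2.1
  have hd (j : I) : Sigma.ι N j ≫ d = j.2.1 := by simp [d]
  obtain ⟨A', t, h, hT⟩ := distinguished_cocone_triangle d
  obtain ⟨a', ha'⟩ := distTriang_desc₂ hT a (Sigma.hom_ext _ _ fun j => by
    rw [← Category.assoc, hd, j.2.2, comp_zero])
  refine ⟨A', a', t, genBy_cone hT (.sigma fun j => genBy_mem P j.1.2) hA, ha'.symm, ?_⟩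
  intro i hi z hz
  rw [show z = Sigma.ι N ⟨⟨i, hi⟩, z, hz⟩ ≫ d from (hd ⟨⟨i, hi⟩, z, hz⟩).symm, Category.assoc,
    distTriang_comp₁₂ hT, comp_zero]

/-- The first stage maps onto all of `Hom(P⟦i⟧, M)`, `i ≥ n`, and each later stage kills the kernel
left by the previous one. Since `P⟦i⟧` is finitary, on the homotopy colimit `A` the map to
`Hom(P⟦i⟧, M)` is also injective, and the cone is orthogonal. -/
lemma exists_truncation_triangle {P : C} (hP : IsFinitary P)
    (hconn : IsConnective (ObjectProperty.singleton P)) (n : ℤ) (M : C) :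
    ∃ (A B : C) (f : A ⟶ M) (g : M ⟶ B) (h : B ⟶ A⟦(1 : ℤ)⟧),
      genBy P {i | n ≤ i} A ∧ perpBy P {i | n ≤ i} B ∧ Triangle.mk f g h ∈ distTriang C := by
  -- The choices carry information only for objects in the class; `hseq` keeps the sequence there.
  choose! next nextMap t hnext hcomp hkill using
    fun (A : C) (a : A ⟶ M) (hA : genBy P {i | n ≤ i} A) => exists_kill_kernel hA a
  let N : (Σ i : {i : ℤ // n ≤ i}, (P⟦i.1⟧ ⟶ M)) → C := fun j => P⟦j.1.1⟧
  let a₀ : ∐ N ⟶ M := Sigma.desc fun j => j.2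
  have ha₀ (j) : Sigma.ι N j ≫ a₀ = j.2 := by simp [a₀]
  let seq : ℕ → Σ A : C, A ⟶ M :=
    fun m => Nat.rec ⟨∐ N, a₀⟩ (fun _ p => ⟨next p.1 p.2, nextMap p.1 p.2⟩) m
  have hseq (m) : genBy P {i | n ≤ i} (seq m).1 := by
    induction m with
    | zero => exact .sigma fun j => genBy_mem P j.1.2
    | succ m ih => exact hnext _ (seq m).2 ih
  obtain ⟨A, f, g, h, α, hT, hα, hdesc, hfin⟩ :=
    exists_homotopy_colimit (A := fun m => (seq m).1) fun m => t (seq m).1 (seq m).2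
  obtain ⟨k, hk⟩ := hdesc (fun m => (seq m).2) fun m => hcomp _ (seq m).2 (hseq m)
  have hA : genBy P {i | n ≤ i} A := genBy_cone hT (.sigma fun m => hseq _) (.sigma fun m => hseq _)
  obtain ⟨B, p, q, hB⟩ := distinguished_cocone_triangle k
  refine ⟨A, B, k, p, q, hA, ?_, hB⟩
  have hinj (i : ℤ) (hi : n ≤ i) (x : P⟦i⟧ ⟶ A) (hx : x ≫ k = 0) : x = 0 := by
    obtain ⟨m, y, rfl⟩ := hfin (hP.shift i) x
    rw [Category.assoc, hk] at hx
    rw [← hα, ← Category.assoc, hkill _ (seq m).2 (hseq m) i hi y hx, zero_comp]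
  -- Injectivity after a shift concerns `P⟦i - 1⟧`. For `i = n` it falls below the range of `hinj`,
  -- but `P⟦n - 1⟧` has no maps to `A` by connectivity.
  have hinj' (i : ℤ) (hi : n ≤ i) (x : P⟦i⟧ ⟶ A⟦(1 : ℤ)⟧) (hx : x ≫ k⟦(1 : ℤ)⟧' = 0) :
      x = 0 := by
    let e : P⟦i⟧ ≅ (P⟦i - 1⟧)⟦(1 : ℤ)⟧ := (shiftFunctorAdd' C (i - 1) 1 i (by lia)).app P
    obtain ⟨y, hy⟩ := (shiftFunctor C (1 : ℤ)).map_surjective (e.inv ≫ x)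
    suffices y = 0 by rw [← cancel_epi e.inv, ← hy, this, Functor.map_zero, comp_zero]
    rcases hi.lt_or_eq with hi | rfl
    · refine hinj _ (by lia) y ((shiftFunctor C (1 : ℤ)).map_injective ?_)
      rw [Functor.map_comp, hy, Category.assoc, hx, comp_zero, Functor.map_zero]
    · exact perpBy_iff.1 (genBy_le_perpBy hP hconn (S' := {i | i < n})
        (fun i (hi : i < n) j (hj : n ≤ j) => hi.trans_le hj) hA) (n - 1)
        (show n - 1 < n by lia) y
  rw [perpBy_iff]
  intro i hi x
  have hx : x ≫ q = 0 := hinj' i hi _ (by rw [Category.assoc, distTriang_comp₃₁ hB, comp_zero])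
  obtain ⟨y, rfl⟩ := distTriang_lift₃ hB x hx
  obtain ⟨z, rfl⟩ : ∃ z : P⟦i⟧ ⟶ A, y = z ≫ k :=
    ⟨Sigma.ι N ⟨⟨i, hi⟩, y⟩ ≫ α 0, by rw [Category.assoc, hk]; exact (ha₀ ⟨⟨i, hi⟩, y⟩).symm⟩
  rw [Category.assoc, distTriang_comp₁₂ hB, comp_zero]

end TruncationTriangle

/-! ### The adjacent t-structure -/

section TStructure

variable {C : Type u} [Category.{v} C] [Preadditive C] [HasZeroObject C] [HasShift C ℤ]
  [∀ n : ℤ, (shiftFunctor C n).Additive] [Pretriangulated C] [IsTriangulated C]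
  [HasCoproducts.{v} C]

lemma perpBy_mono {P : C} {S S' : Set ℤ} (h : S' ⊆ S) : perpBy P S ≤ perpBy P S' :=
  fun _ hX _ f hY => hX f (shifts_singleton_mono P h _ hY)

/-- The t-structure generated by a finitary connective generator. -/
def tStructure {P : C} (hP : IsFinitary P)
    (hconn : IsConnective (ObjectProperty.singleton P)) (hgen : genBy P Set.univ = ⊤) :
    TStructure C where
  -- The signs convert the homological convention to the cohomological one.
  le n := perpBy P {i | i < -n}
  ge n := perpBy P {i | -n < i}
  le_isClosedUnderIsomorphisms n := by dsimp [perpBy]; infer_instance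
  ge_isClosedUnderIsomorphisms n := by dsimp [perpBy]; infer_instance
  le_shift n a n' h X hX := perpBy_shift (fun i (hi : i < -n') => show i - a < -n by lia) hX
  ge_shift n a n' h X hX := perpBy_shift (fun i (hi : -n' < i) => show -n < i - a by lia) hX
  zero' X Y f hX hY := by
    rw [neg_zero, ← genBy_ge_eq_perpBy hP hconn hgen] at hX
    exact genBy_hom_eq_zero hX (perpBy_mono (fun i (hi : 0 ≤ i) => show -1 < i by lia) _ hY) f
  le_zero_le := perpBy_mono fun i (hi : i < -1) => show i < -0 by lia
  ge_one_le := perpBy_mono fun i (hi : -0 < i) => show -1 < i by lia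
  exists_triangle_zero_one M := by
    obtain ⟨A, B, f, g, h, hA, hB, hT⟩ := exists_truncation_triangle hP hconn 0 M
    rw [genBy_ge_eq_perpBy hP hconn hgen] at hA
    exact ⟨A, B, by simpa using hA,
      perpBy_mono (fun i (hi : -1 < i) => show 0 ≤ i by lia) _ hB, f, g, h, hT⟩

end TStructure

/-! ### Modules and the two hearts -/

section Hearts

variable {C : Type u} [Category.{v} C] [Preadditive C]

/-- Composition with `f : X ⟶ Y` as a linear map `Hom(P, X) → Hom(P, Y)`. -/
def postcompLinear (P : C) {X Y : C} (f : X ⟶ Y) : (P ⟶ X) →ₗ[(End P)ᵐᵒᵖ] (P ⟶ Y) :=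
  ((preadditiveCoyonedaObj P).map f).hom

@[simp]
lemma postcompLinear_apply (P : C) {X Y : C} (f : X ⟶ Y) (x : P ⟶ X) :
    postcompLinear P f x = x ≫ f := rfl

variable [HasCoproducts.{v} C]

/-- `Hom(P, ∐_I P)` is a free module on the inclusions of the summands. -/
def freeEquiv {P : C} (hP : IsFinitary P) (I : Type v) :
    (I →₀ (End P)ᵐᵒᵖ) ≃ₗ[(End P)ᵐᵒᵖ] (P ⟶ ∐ fun _ : I => P) :=
  LinearEquiv.ofBijective
    (Finsupp.linearCombination (End P)ᵐᵒᵖ fun i => Sigma.ι (fun _ : I => P) i) <| by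
    classical
    have key (c : I →₀ (End P)ᵐᵒᵖ) : Finsupp.linearCombination (End P)ᵐᵒᵖ
        (fun i => Sigma.ι (fun _ : I => P) i) c =
        ∑ i ∈ c.support, (c i).unop ≫ (Cofan.mk _ (Sigma.ι (fun _ : I => P))).inj i := rfl
    constructor
    · rw [injective_iff_map_eq_zero]
      intro c hc
      rw [key] at hc
      ext i
      by_contra hi
      have := sum_comp_cofanProj (coproductIsCoproduct fun _ : I => P) c.support
        (fun i => (c i).unop) i
      rw [hc, zero_comp, if_pos (by simpa using hi)] at this
      exact hi (MulOpposite.unop_injective this.symm)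
    · intro x
      obtain ⟨s, y, rfl⟩ := hP _ _ (coproductIsCoproduct fun _ : I => P) x
      refine ⟨∑ i ∈ s, Finsupp.single i (MulOpposite.op (y i)), ?_⟩
      rw [map_sum]
      refine Finset.sum_congr rfl fun i _ => ?_
      rw [Finsupp.linearCombination_single]
      rfl

lemma freeEquiv_single {P : C} (hP : IsFinitary P) {I : Type v} (i : I) :
    freeEquiv hP I (Finsupp.single i 1) = Sigma.ι (fun _ : I => P) i :=
  (LinearEquiv.ofBijective_apply _ _).trans (by
    rw [Finsupp.linearCombination_single, one_smul])

lemma projective_of_retract {P : C} (hP : IsFinitary P) {X : C} {I : Type v}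
    (r : Retract X (∐ fun _ : I => P)) : Module.Projective (End P)ᵐᵒᵖ (P ⟶ X) := by
  have : Module.Projective (End P)ᵐᵒᵖ (P ⟶ ∐ fun _ : I => P) :=
    Module.Projective.of_equiv (freeEquiv hP I)
  exact Module.Projective.of_split (postcompLinear P r.i) (postcompLinear P r.r)
    (LinearMap.ext fun x => by simp)

/-- With `linear_ext_of_coproduct`, this is the universal property of the free module `Hom(P, ∐_I
P)`. -/
lemma exists_linear_of_family {P : C} (hP : IsFinitary P) {I : Type v} {Q : Type v}
    [AddCommGroup Q] [Module (End P)ᵐᵒᵖ Q] (q : I → Q) :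
    ∃ Φ : (P ⟶ ∐ fun _ : I => P) →ₗ[(End P)ᵐᵒᵖ] Q, ∀ i, Φ (Sigma.ι (fun _ : I => P) i) = q i :=
  ⟨Finsupp.linearCombination (End P)ᵐᵒᵖ q ∘ₗ (freeEquiv hP I).symm.toLinearMap, fun i => by
    rw [← freeEquiv_single hP]; simp⟩

lemma linear_ext_of_coproduct {P : C} (hP : IsFinitary P) {I : Type v} {Q : Type v}
    [AddCommGroup Q] [Module (End P)ᵐᵒᵖ Q] {Φ Ψ : (P ⟶ ∐ fun _ : I => P) →ₗ[(End P)ᵐᵒᵖ] Q}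
    (h : ∀ i, Φ (Sigma.ι (fun _ : I => P) i) = Ψ (Sigma.ι (fun _ : I => P) i)) : Φ = Ψ := by
  have : Φ ∘ₗ (freeEquiv hP I).toLinearMap = Ψ ∘ₗ (freeEquiv hP I).toLinearMap := by
    ext i
    simp [freeEquiv_single, h]
  ext x
  simpa using LinearMap.congr_fun this ((freeEquiv hP I).symm x)

/-- A linear map on `Hom(P, X)` restricts to a morphism on any coproduct of copies of `P`
over `X`. -/
lemma exists_hom_of_linear {P : C} (hP : IsFinitary P) {I : Type v} {X Y : C}
    (p : (∐ fun _ : I => P) ⟶ X) (φ : (P ⟶ X) →ₗ[(End P)ᵐᵒᵖ] (P ⟶ Y)) :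
    ∃ a : (∐ fun _ : I => P) ⟶ Y, ∀ h, h ≫ a = φ (h ≫ p) := by
  refine ⟨Sigma.desc fun i => φ (Sigma.ι (fun _ : I => P) i ≫ p), fun h => ?_⟩
  have : postcompLinear P (Sigma.desc fun i => φ (Sigma.ι (fun _ : I => P) i ≫ p)) =
      φ ∘ₗ postcompLinear P p := linear_ext_of_coproduct hP fun i => by simp
  exact LinearMap.congr_fun this h

lemma eq_zero_of_retract {P X Y : C} {I : Type v} (r : Retract X (∐ fun _ : I => P)) (f : X ⟶ Y)
    (hf : ∀ x : P ⟶ X, x ≫ f = 0) : f = 0 := by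
  have : r.r ≫ f = 0 := Sigma.hom_ext _ _ fun i => by rw [← Category.assoc, hf, comp_zero]
  rw [← Category.id_comp f, ← r.retract, Category.assoc, this, comp_zero]

lemma exists_hom_of_retract {P : C} (hP : IsFinitary P) {X Y : C} {I : Type v}
    (r : Retract X (∐ fun _ : I => P)) (φ : (P ⟶ X) →ₗ[(End P)ᵐᵒᵖ] (P ⟶ Y)) :
    ∃ f : X ⟶ Y, ∀ x, x ≫ f = φ x := by
  obtain ⟨a, ha⟩ := exists_hom_of_linear hP r.r φ
  exact ⟨r.i ≫ a, fun x => by rw [← Category.assoc, ha]; simp⟩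

variable [HasZeroObject C] [HasShift C ℤ] [∀ n : ℤ, (shiftFunctor C n).Additive]
  [Pretriangulated C]

/-- Every projective module is `Hom(P, X)` for a retract `X` of a coproduct of copies of `P`. -/
lemma exists_retract_of_projective {P : C} (hP : IsFinitary P) (Q : Type v) [AddCommGroup Q]
    [Module (End P)ᵐᵒᵖ Q] [Module.Projective (End P)ᵐᵒᵖ Q] :
    ∃ X : C, Nonempty (Retract X (∐ fun _ : Q => P)) ∧
      Nonempty ((P ⟶ X) ≃ₗ[(End P)ᵐᵒᵖ] Q) := by
  obtain ⟨Φ, hΦ⟩ := exists_linear_of_family hP (id : Q → Q)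
  obtain ⟨σ, hσ⟩ := Module.projective_lifting_property Φ LinearMap.id fun q => ⟨_, hΦ q⟩
  have hσ' (q) : Φ (σ q) = q := LinearMap.congr_fun hσ q
  -- `Φ` is a free cover of `Q` with section `σ`, so `σ ∘ Φ` is idempotent with image `Q`. It lifts
  -- to an idempotent of the coproduct, which splits.
  obtain ⟨e, he⟩ := exists_hom_of_retract hP (Retract.refl _) (σ ∘ₗ Φ)
  have hee : e ≫ e = e := by
    rw [← sub_eq_zero]
    refine eq_zero_of_retract (Retract.refl _) _ fun x => ?_
    rw [Preadditive.comp_sub, ← Category.assoc, he, he]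
    simp [hσ']
  obtain ⟨X, -, -, i, p, -, hip, hpi⟩ := exists_splitting_of_idempotent e hee
  refine ⟨X, ⟨⟨i, p, hip⟩⟩, ⟨LinearEquiv.ofLinearMap (Φ ∘ₗ postcompLinear P i)
    (postcompLinear P p ∘ₗ σ) (LinearMap.ext fun q => ?_) (LinearMap.ext fun x => ?_)⟩⟩
  · have := he (σ q)
    simp only [LinearMap.comp_apply, postcompLinear_apply, Category.assoc, hpi, this, hσ',
      LinearMap.id_apply]
  · have := he (x ≫ i)
    simp only [LinearMap.comp_apply, postcompLinear_apply, LinearMap.id_apply] at this ⊢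
    rw [← this, ← hpi]
    simp [hip]

lemma hom_eq_zero_of_perpBy {P : C} {S : Set ℤ} (h : 0 ∈ S) {X : C} (hX : perpBy P S X)
    (f : P ⟶ X) : f = 0 :=
  genBy_hom_eq_zero (genBy_self P h) hX f

variable [IsTriangulated C]

/-- The cover uses one copy of `P` for each map `P ⟶ X`. Maps from `P⟦i⟧`, `i < 1`, to the cone lift
to `X`; they are zero there for `i < 0`, and factor through the cover for `i = 0`. -/
lemma exists_cover {P : C} (hP : IsFinitary P)
    (hconn : IsConnective (ObjectProperty.singleton P)) (hgen : genBy P Set.univ = ⊤)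
    {X : C} (hX : genBy P {i | 0 ≤ i} X) :
    ∃ (I : Type v) (p : (∐ fun _ : I => P) ⟶ X) (N : C) (g : X ⟶ N)
      (h : N ⟶ (∐ fun _ : I => P)⟦(1 : ℤ)⟧), Triangle.mk p g h ∈ distTriang C ∧
      genBy P {i | 1 ≤ i} N ∧ ∀ x : P ⟶ X, ∃ y, x = y ≫ p := by
  let p : (∐ fun _ : (P ⟶ X) => P) ⟶ X := Sigma.desc id
  have hp (x : P ⟶ X) : x = Sigma.ι (fun _ : (P ⟶ X) => P) x ≫ p := by simp [p]
  obtain ⟨N, g, h, hT⟩ := distinguished_cocone_triangle p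
  refine ⟨_, p, N, g, h, hT, ?_, fun x => ⟨_, hp x⟩⟩
  rw [genBy_ge_eq_perpBy hP hconn hgen] at hX ⊢
  have hS : genBy P {i | 1 ≤ i} ((∐ fun _ : (P ⟶ X) => P)⟦(1 : ℤ)⟧) :=
    genBy_shift (S := {i | 0 ≤ i}) (fun i (hi : 0 ≤ i) => show 1 ≤ i + 1 by lia)
      (.sigma fun _ => genBy_self P (by simp))
  rw [genBy_ge_eq_perpBy hP hconn hgen, perpBy_iff] at hS
  rw [perpBy_iff] at hX ⊢
  intro i hi x
  obtain ⟨y, rfl⟩ := distTriang_lift₃ hT x (hS i hi _)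
  obtain hi' | rfl : i < 0 ∨ i = 0 := by have : i < 1 := hi; lia
  · rw [hX i hi' y, zero_comp]
  · let e : P⟦(0 : ℤ)⟧ ≅ P := (shiftFunctorZero C ℤ).app P
    rw [← cancel_epi e.inv, ← Category.assoc, hp (e.inv ≫ y), Category.assoc,
      distTriang_comp₁₂ hT, comp_zero, comp_zero]

/-- Orthogonality kills the map from `X` to the cone of its cover, so the cover splits. -/
lemma retract_of_heart {P : C} (hP : IsFinitary P)
    (hconn : IsConnective (ObjectProperty.singleton P)) (hgen : genBy P Set.univ = ⊤)
    {X : C} (hge : genBy P {i | 0 ≤ i} X) (hle : genBy P {i | i ≤ 0} X) :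
    ∃ I : Type v, Nonempty (Retract X (∐ fun _ : I => P)) := by
  obtain ⟨I, p, N, g, h, hT, hN, -⟩ := exists_cover hP hconn hgen hge
  have hg : g = 0 := genBy_hom_eq_zero hle (genBy_le_perpBy hP hconn
    (fun i (hi : i ≤ 0) j (hj : 1 ≤ j) => by lia) hN) g
  obtain ⟨s, hs⟩ := distTriang_lift₂ hT (𝟙 X) (by simp [hg])
  exact ⟨I, ⟨⟨s, p, hs.symm⟩⟩⟩

/-- Such an `f` vanishes on the cover, hence factors through the cone, which has no maps to `Y`. -/
lemma eq_zero_of_ge {P : C} (hP : IsFinitary P)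
    (hconn : IsConnective (ObjectProperty.singleton P)) (hgen : genBy P Set.univ = ⊤)
    {X Y : C} (hX : genBy P {i | 0 ≤ i} X) (hY : perpBy P {i | 0 < i} Y)
    (f : X ⟶ Y) (hf : ∀ x : P ⟶ X, x ≫ f = 0) : f = 0 := by
  obtain ⟨I, p, N, g, h, hT, hN, -⟩ := exists_cover hP hconn hgen hX
  obtain ⟨k, rfl⟩ := distTriang_desc₂ hT f
    (Sigma.hom_ext _ _ fun i => by rw [← Category.assoc, hf, comp_zero])
  rw [genBy_hom_eq_zero hN (perpBy_mono (fun i (hi : 1 ≤ i) => show 0 < i by lia) _ hY) k,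
    comp_zero]

/-- `φ` gives a map on the cover of `X`. It descends to `X` if it vanishes on the fibre `N⟦-1⟧`; by
`eq_zero_of_ge` this may be tested on maps from `P`, where it follows from `φ 0 = 0`. -/
lemma exists_hom_of_ge {P : C} (hP : IsFinitary P)
    (hconn : IsConnective (ObjectProperty.singleton P)) (hgen : genBy P Set.univ = ⊤)
    {X Y : C} (hX : genBy P {i | 0 ≤ i} X) (hY : perpBy P {i | 0 < i} Y)
    (φ : (P ⟶ X) →ₗ[(End P)ᵐᵒᵖ] (P ⟶ Y)) : ∃ f : X ⟶ Y, ∀ x, x ≫ f = φ x := by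
  obtain ⟨I, p, N, g, h, hT, hN, hsurj⟩ := exists_cover hP hconn hgen hX
  obtain ⟨a, ha⟩ := exists_hom_of_linear hP p φ
  obtain ⟨u, w, hT'⟩ := distTriang_invRotate hT
  have hN' : genBy P {i | 0 ≤ i} (N⟦(-1 : ℤ)⟧) :=
    genBy_shift (fun i (hi : 1 ≤ i) => show 0 ≤ i + -1 by lia) hN
  obtain ⟨f, rfl⟩ := distTriang_desc₂ hT' a
    (eq_zero_of_ge hP hconn hgen hN' hY _ fun x => by
      rw [← Category.assoc, ha, Category.assoc, distTriang_comp₁₂ hT', comp_zero, map_zero])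
  refine ⟨f, fun x => ?_⟩
  obtain ⟨y, rfl⟩ := hsurj x
  rw [← ha, Category.assoc]

/-- Every module is `Hom(P, X)` for an object `X` of the heart of the t-structure. -/
lemma exists_heart_of_module {P : C} (hP : IsFinitary P)
    (hconn : IsConnective (ObjectProperty.singleton P))
    (Q : Type v) [AddCommGroup Q] [Module (End P)ᵐᵒᵖ Q] :
    ∃ X : C, genBy P {i | 0 ≤ i} X ∧ perpBy P {i | 0 < i} X ∧
      Nonempty ((P ⟶ X) ≃ₗ[(End P)ᵐᵒᵖ] Q) := by
  obtain ⟨Φ, hΦ⟩ := exists_linear_of_family hP (id : Q → Q)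
  let S := ∐ fun _ : Q => P
  let J := LinearMap.ker Φ
  let d : (∐ fun _ : J => P) ⟶ S := Sigma.desc fun j => j.1
  have hd (j : J) : Sigma.ι (fun _ : J => P) j ≫ d = j.1 := by simp [d]
  -- `Hom(P, K)` is the cokernel of the presentation, namely `Q`. Truncating at level `1` removes
  -- the maps from `P⟦i⟧`, `i > 0`, and leaves `Hom(P, -)` unchanged.
  obtain ⟨K, g, k, hK⟩ := distinguished_cocone_triangle d
  have hJ : genBy P {i | 0 ≤ i} (∐ fun _ : J => P) := .sigma fun _ => genBy_self P (by simp)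
  have hS : genBy P {i | 0 ≤ i} S := .sigma fun _ => genBy_self P (by simp)
  have hK' : genBy P {i | 0 ≤ i} K := genBy_cone hK hJ hS
  have hpos {Z : C} (hZ : genBy P {i | 1 ≤ i} Z) (x : P ⟶ Z) : x = 0 :=
    hom_eq_zero_of_perpBy (S := {i | i < 1}) (by simp) (genBy_le_perpBy hP hconn
      (fun i (hi : i < 1) j (hj : 1 ≤ j) => by lia) hZ) x
  obtain ⟨A, X, a, b, c, hA, hX, hT⟩ := exists_truncation_triangle hP hconn 1 K
  have hA₁ : genBy P {i | 1 ≤ i} (A⟦(1 : ℤ)⟧) :=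
    genBy_shift (fun i (hi : 1 ≤ i) => show 1 ≤ i + 1 by lia) hA
  have hJ₁ : genBy P {i | 1 ≤ i} ((∐ fun _ : J => P)⟦(1 : ℤ)⟧) :=
    genBy_shift (fun i (hi : 0 ≤ i) => show 1 ≤ i + 1 by lia) hJ
  refine ⟨X, genBy_cone hT (genBy_mono (fun i (hi : 1 ≤ i) => show 0 ≤ i by lia) hA) hK',
    perpBy_mono (fun i (hi : 0 < i) => show 1 ≤ i by lia) _ hX, ?_⟩
  let Ψ := postcompLinear P (g ≫ b)
  have hΨ : Function.Surjective Ψ := fun x => by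
    obtain ⟨y, rfl⟩ := distTriang_lift₃ hT x (hpos hA₁ _)
    obtain ⟨z, rfl⟩ := distTriang_lift₃ hK y (hpos hJ₁ _)
    exact ⟨z, by simp [Ψ]⟩
  have hker : LinearMap.ker Ψ = LinearMap.ker Φ := by
    ext x
    rw [LinearMap.mem_ker, LinearMap.mem_ker]
    constructor
    · intro hx
      obtain ⟨y, hy⟩ := distTriang_lift₂ hT (x ≫ g) (by simpa [Ψ] using hx)
      rw [hpos hA y, zero_comp] at hy
      obtain ⟨z, rfl⟩ := distTriang_lift₂ hK x hy
      have : Φ ∘ₗ postcompLinear P d = 0 := linear_ext_of_coproduct hP fun j => by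
        simp [hd]
      exact LinearMap.congr_fun this z
    · intro hx
      have h := hd ⟨x, hx⟩
      dsimp only at h
      rw [← h]
      simp only [Ψ, postcompLinear_apply, Category.assoc]
      rw [← Category.assoc d, distTriang_comp₁₂ hK, zero_comp, comp_zero]
  exact ⟨(Ψ.quotKerEquivOfSurjective hΨ).symm ≪≫ₗ Submodule.quotEquivOfEq _ _ hker ≪≫ₗ
    Φ.quotKerEquivOfSurjective fun q => ⟨_, hΦ q⟩⟩

end Hearts

/-! ### The equivalences of categories -/

section Equivalences

variable {C : Type u} [Category.{v} C] [Preadditive C] [HasCoproducts.{v} C]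

/-- Corepresentation by `P` is an equivalence onto the projective modules on any class consisting
of the retracts of coproducts of copies of `P`. -/
lemma nonempty_equivalence_projMod [HasZeroObject C] [HasShift C ℤ]
    [∀ n : ℤ, (shiftFunctor C n).Additive] [Pretriangulated C] {P : C} (hP : IsFinitary P)
    (H : ObjectProperty C)
    (hH : ∀ X, H X ↔ ∃ I : Type v, Nonempty (Retract X (∐ fun _ : I => P))) :
    Nonempty (H.FullSubcategory ≌ ProjMod (End P)ᵐᵒᵖ) := by
  let F : H.FullSubcategory ⥤ ProjMod (End P)ᵐᵒᵖ :=
    ObjectProperty.lift _ (H.ι ⋙ preadditiveCoyonedaObj P) fun X => by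
      obtain ⟨I, ⟨r⟩⟩ := (hH _).1 X.property
      exact projective_of_retract hP r
  have hfaithful : F.Faithful := ⟨fun {X Y f g} hfg => by
    obtain ⟨I, ⟨r⟩⟩ := (hH _).1 X.property
    apply H.hom_ext
    rw [← sub_eq_zero]
    refine eq_zero_of_retract r _ fun x => ?_
    rw [Preadditive.comp_sub, sub_eq_zero]
    exact LinearMap.congr_fun (congrArg (fun k => k.hom.hom) hfg) x⟩
  have hfull : F.Full := ⟨fun {X Y} φ => by
    obtain ⟨I, ⟨r⟩⟩ := (hH _).1 X.property
    obtain ⟨f, hf⟩ := exists_hom_of_retract hP r φ.hom.hom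
    exact ⟨ObjectProperty.homMk f, ObjectProperty.hom_ext _ (ModuleCat.hom_ext
      (LinearMap.ext hf))⟩⟩
  have hsurj : F.EssSurj := ⟨fun Q => by
    have : Module.Projective (End P)ᵐᵒᵖ Q.obj := Q.property
    obtain ⟨X, hX, ⟨e⟩⟩ := exists_retract_of_projective hP Q.obj
    exact ⟨⟨X, (hH X).2 ⟨_, hX⟩⟩, ⟨ObjectProperty.isoMk _ e.toModuleIso⟩⟩⟩
  have : F.IsEquivalence := {}
  exact ⟨F.asEquivalence⟩

variable [HasZeroObject C] [HasShift C ℤ] [∀ n : ℤ, (shiftFunctor C n).Additive]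
  [Pretriangulated C] [IsTriangulated C]

lemma nonempty_equivalence_moduleCat {P : C} (hP : IsFinitary P)
    (hconn : IsConnective (ObjectProperty.singleton P)) (hgen : genBy P Set.univ = ⊤)
    (H : ObjectProperty C)
    (hH : ∀ X, H X ↔ genBy P {i | 0 ≤ i} X ∧ perpBy P {i | 0 < i} X) :
    Nonempty (H.FullSubcategory ≌ ModuleCat.{v} (End P)ᵐᵒᵖ) := by
  let F : H.FullSubcategory ⥤ ModuleCat.{v} (End P)ᵐᵒᵖ := H.ι ⋙ preadditiveCoyonedaObj P
  have hfaithful : F.Faithful := ⟨fun {X Y f g} hfg => by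
    apply H.hom_ext
    rw [← sub_eq_zero]
    refine eq_zero_of_ge hP hconn hgen ((hH _).1 X.property).1 ((hH _).1 Y.property).2 _
      fun x => ?_
    rw [Preadditive.comp_sub, sub_eq_zero]
    exact LinearMap.congr_fun (congrArg (fun k => k.hom) hfg) x⟩
  have hfull : F.Full := ⟨fun {X Y} φ => by
    obtain ⟨f, hf⟩ := exists_hom_of_ge hP hconn hgen ((hH _).1 X.property).1
      ((hH _).1 Y.property).2 φ.hom
    exact ⟨ObjectProperty.homMk f, ModuleCat.hom_ext (LinearMap.ext hf)⟩⟩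
  have hsurj : F.EssSurj := ⟨fun Q => by
    obtain ⟨X, hX, hX', ⟨e⟩⟩ := exists_heart_of_module hP hconn Q
    exact ⟨⟨X, (hH X).2 ⟨hX, hX'⟩⟩, ⟨e.toModuleIso⟩⟩⟩
  have : F.IsEquivalence := {}
  exact ⟨F.asEquivalence⟩

/-- For the converse, `P` lies in both classes, and both are closed under coproducts and retracts.
-/
lemma weightStructure_heart_iff {P : C} (hP : IsFinitary P)
    (hconn : IsConnective (ObjectProperty.singleton P)) (hgen : genBy P Set.univ = ⊤) (X : C) :
    (weightStructure hP hconn hgen).heart X ↔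
      ∃ I : Type v, Nonempty (Retract X (∐ fun _ : I => P)) := by
  constructor
  · exact fun h => retract_of_heart hP hconn hgen h.1 h.2
  · rintro ⟨I, ⟨r⟩⟩
    exact ⟨(weightStructure hP hconn hgen).ge_retract.of_retract r
        (.sigma fun _ => genBy_self P (S := {i | 0 ≤ i}) (by simp)),
      (weightStructure hP hconn hgen).le_retract.of_retract r
        (.sigma fun _ => genBy_self P (S := {i | i ≤ 0}) (by simp))⟩

lemma weightStructure_isSmashing {P : C} (hP : IsFinitary P)
    (hconn : IsConnective (ObjectProperty.singleton P)) (hgen : genBy P Set.univ = ⊤) :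
    (weightStructure hP hconn hgen).IsSmashing := by
  have := (weightStructure hP hconn hgen).ge_retract
  refine ⟨inferInstance, fun I => .mk' ?_⟩
  rintro _ ⟨F, hF⟩
  exact extCoprodClosure.of_iso (HasColimit.isoOfNatIso (Discrete.natIsoFunctor (F := F)).symm)
    (.sigma fun i => hF ⟨i⟩)

end Equivalences

end WeightT

end

theorem proposition4p1p1 {C : Type u} [Category.{v} C] [Preadditive C] [HasZeroObject C]
    [HasShift C ℤ] [∀ n : ℤ, (shiftFunctor C n).Additive] [Pretriangulated C] [IsTriangulated C]
    [HasCoproducts.{v} C] (P : C)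
    (hP : WeightT.IsCompactlyGeneratedBy (fun _ : PUnit.{v + 1} => P))
    (hconn : WeightT.IsConnective (ObjectProperty.singleton P)) :
    WeightT.IsWellGenerated C ∧
    ∃ w : WeightT.WeightStructure C,
      w.IsClassGeneratedBy (ObjectProperty.singleton P) ∧
      w.IsSmashing ∧
      Nonempty (w.heart.FullSubcategory ≌ WeightT.ProjMod (End P)ᵐᵒᵖ) ∧
      (∀ X : C, w.heart X ↔ ∃ I : Type v, Nonempty (Retract X (∐ fun _ : I => P))) ∧
      ∃ t : TStructure C,
        w.IsAdjacent t ∧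
        Nonempty (t.heart.FullSubcategory ≌ ModuleCat.{v} (End P)ᵐᵒᵖ) ∧
        t.le 0 = (WeightT.shifts (ObjectProperty.singleton P) {i | i < 0}).rightOrthogonal ∧
        t.ge 0 = (WeightT.shifts (ObjectProperty.singleton P) {i | 0 < i}).rightOrthogonal := by
  have hfin : WeightT.IsFinitary P := hP.1.isFinitary
  have hgen : WeightT.genBy P Set.univ = ⊤ := by
    rw [← hP.2]
    have : ObjectProperty.ofObj (fun _ : PUnit.{v + 1} => P) = ObjectProperty.singleton P := by
      ext X
      simp [ObjectProperty.ofObj_iff]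
    rw [this]
    rfl
  have heart := WeightT.weightStructure_heart_iff hfin hconn hgen
  have hle : (WeightT.tStructure hfin hconn hgen).le 0 = WeightT.perpBy P {i | i < 0} := by
    simp [WeightT.tStructure]
  have hge : (WeightT.tStructure hfin hconn hgen).ge 0 = WeightT.perpBy P {i | 0 < i} := by
    simp [WeightT.tStructure]
  have hadj := WeightT.genBy_ge_eq_perpBy hfin hconn hgen 0
  refine ⟨⟨_, _, _, hP⟩, WeightT.weightStructure hfin hconn hgen, ⟨inferInstance, rfl, rfl⟩,
    WeightT.weightStructure_isSmashing hfin hconn hgen,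
    WeightT.nonempty_equivalence_projMod hfin _ heart, heart,
    WeightT.tStructure hfin hconn hgen, hadj.trans hle.symm,
    WeightT.nonempty_equivalence_moduleCat hfin hconn hgen _ fun X => ?_, hle, hge⟩
  rw [hadj, ← hle, ← hge]
  rfl
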